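/- For $n \in \mathbb{N}$, $n \ge 3$, let $D^1(\mathbb{R}^n)$ be the completion of $C_0^\infty(\mathbb{R}^n)$ (complex-valued functions) with respect to the norm $\big(\int_{\mathbb{R}^n} |\nabla f(x)|^2\, d^n x\big)^{1/2}$, realized via the Sobolev inequality as a space of functions in $L^{2n/(n-2)}(\mathbb{R}^n)$. Let $\gamma_{c,n}$ denote the critical dipole coupling constant, that is, the largest $c \ge 0$ such that for all $\gamma \in [0,c]$, all $u \in \mathbb{R}^n$ with $|u| = 1$, and all $f \in D^1(\mathbb{R}^n)$, the function $(u,x)|x|^{-3}|f(x)|^2$ is integrable and $$\int_{\mathbb{R}^n} |(\nabla f)(x)|^2 \, d^n x \;\ge\; \pm \gamma \int_{\mathbb{R}^n} (u,x)\,|x|^{-3}\,|f(x)|^2 \, d^n x .$$ Theorem 3.3. For every $n \ge 3$ such a largest constant $\gamma_{c,n}$ exists. There is $C_0 \in (0,\infty)$ such that $$\gamma_{c,n} = C_0\,(n-2)(n-4)\,[1+o(1)] \quad \text{as } n \to \infty .$$ Moreover, for every $n \ge 3$, $$\frac{15\pi\,[(n-2)(n-4)+4]}{32} \;\ge\; \gamma_{c,n}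 \;\ge\; \begin{cases} 1/4, & n=3,\\ 1, & n=4,\\ 3^{3/2}\,[(n-2)(n-4)+1]/8, & n \ge 5. \end{cases}$$ -/

import Mathlib

open MeasureTheory Filter Topology
open scoped ContDiff ENNReal

noncomputable section

namespace Dipole

/-- The complex gradient `(∂₁ f, …, ∂ₙ f)` of a function `f : ℝⁿ → ℂ`; its Euclidean norm squared
is `∑ i, |∂ᵢ f|²`. -/
def grad {n : ℕ} (f : EuclideanSpace ℝ (Fin n) → ℂ) (x : EuclideanSpace ℝ (Fin n)) :
    EuclideanSpace ℂ (Fin n) :=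
  WithLp.toLp 2 fun i => fderiv ℝ f x (EuclideanSpace.single i (1 : ℝ))

/-- The Sobolev exponent `2* = 2n / (n - 2)`, used for `n ≥ 3` only. -/
def sobolevExponent (n : ℕ) : ℝ≥0∞ := ENNReal.ofReal (2 * (n : ℝ) / ((n : ℝ) - 2))

/-- `f` belongs to `D¹(ℝⁿ)`, `n ≥ 3`, and has gradient `G`. The space `D¹(ℝⁿ)` is the completion
of `C₀^∞(ℝⁿ)` in the norm `‖∇ φ‖_{L²}`, realized, as the Sobolev inequality permits, as a space
of functions in `L^{2*}(ℝⁿ)`: `f` is the `L^{2*}`-limit of test functions whose gradients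
converge in `L²` to `G`. -/
structure HasD1Gradient {n : ℕ} (f : EuclideanSpace ℝ (Fin n) → ℂ)
    (G : EuclideanSpace ℝ (Fin n) → EuclideanSpace ℂ (Fin n)) : Prop where
  memLp : MemLp f (sobolevExponent n) volume
  memLp_gradient : MemLp G 2 volume
  exists_approx : ∃ φ : ℕ → EuclideanSpace ℝ (Fin n) → ℂ,
    (∀ j, ContDiff ℝ ∞ (φ j) ∧ HasCompactSupport (φ j)) ∧
    Tendsto (fun j => eLpNorm (φ j - f) (sobolevExponent n) volume) atTop (𝓝 0) ∧
    Tendsto (fun j => eLpNorm (grad (φ j) - G) 2 volume) atTop (𝓝 0)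

/-- The dipole Hardy inequality with coupling constant `γ`: for every unit vector `u` and every
`f ∈ D¹(ℝⁿ)`, the function `(u,x)|x|⁻³|f|²` is integrable and
`∫ |∇f|² ≥ ± γ ∫ (u,x) |x|⁻³ |f|²`. -/
def DipoleHardy (n : ℕ) (γ : ℝ) : Prop :=
  ∀ u : EuclideanSpace ℝ (Fin n), ‖u‖ = 1 →
  ∀ (f : EuclideanSpace ℝ (Fin n) → ℂ) (G : EuclideanSpace ℝ (Fin n) → EuclideanSpace ℂ (Fin n)),
    HasD1Gradient f G →
    Integrable (fun x => inner ℝ u x / ‖x‖ ^ 3 * ‖f x‖ ^ 2) volume ∧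
    γ * ∫ x, inner ℝ u x / ‖x‖ ^ 3 * ‖f x‖ ^ 2 ≤ ∫ x, ‖G x‖ ^ 2 ∧
    -γ * ∫ x, inner ℝ u x / ‖x‖ ^ 3 * ‖f x‖ ^ 2 ≤ ∫ x, ‖G x‖ ^ 2

/-- The constants `c ≥ 0` such that the dipole Hardy inequality holds for all `γ ∈ [0, c]`. -/
def admissibleConstants (n : ℕ) : Set ℝ :=
  {c | 0 ≤ c ∧ ∀ γ ∈ Set.Icc 0 c, DipoleHardy n γ}

/-- The critical dipole coupling constant `γ_{c,n}`: the largest admissible constant. -/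
def criticalConstant (n : ℕ) : ℝ := sSup (admissibleConstants n)

end Dipole

end

open MeasureTheory Filter Topology
open scoped ContDiff ENNReal

noncomputable section

namespace Dipole

variable {n : ℕ}

/-! Admissible lower bounds come from Hardy inequalities, upper bounds from trial functions.

Lower bounds: a Hardy weight that dominates the dipole potential is integrated against `‖f‖²`. Two
weights are used, treated together through a vector `b` that is zero or a unit vector. With `b = 0`
the weight is `|x|⁻²`, with Hardy constant `((n - 2) / 2)²`, and it dominates the potential
trivially; this settles `n = 3, 4`. With `b = u` the weight is the inverse squared distance to the
dipole axis, with constant `((n - 3) / 2)²`. Since `cos θ sin² θ ≤ 2 / (3√3)`, this gives `3√3 / 8 *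
(n - 3)²`, and `(n - 3)² = (n - 2)(n - 4) + 1`. `HasD1Gradient.hardy` and `HasD1Gradient.dipole`
carry this half.

Upper bounds: a Gaussian displaced along the axis concentrates, for large `n`, near the angle `cos θ
= 1/√3` at which the pointwise bound is sharp. It yields `γ ≤ 3√3 / 8 * n (n + 2)`
(`DipoleHardy.le_gaussian_bound`), which matches the lower bound to leading order, so `C₀ = 3√3 /
8`. For small `n` this misses the stated upper bound. There the trial functions are `|x|^(-(n-2)/2)
χ(log |x|) (1 + t cos θ)`, with the radial profile stretched until its derivative costs nothing
(`DipoleHardy.le_of_log_scaling`).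

The largest constant exists because the inequality is a closed condition on `γ`, passes to smaller
couplings, and fails for large ones. -/

/-! ### Gradients, test functions and the divergence theorem -/

theorem norm_grad_sq (f : EuclideanSpace ℝ (Fin n) → ℂ) (x : EuclideanSpace ℝ (Fin n)) :
    ‖grad f x‖ ^ 2 = ∑ i, ‖fderiv ℝ f x (EuclideanSpace.single i (1 : ℝ))‖ ^ 2 := by
  rw [EuclideanSpace.norm_sq_eq]
  rfl

theorem continuous_grad {f : EuclideanSpace ℝ (Fin n) → ℂ} (hf : ContDiff ℝ ∞ f) :
    Continuous (grad f) := by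
  have h := hf.continuous_fderiv (by simp)
  unfold grad
  fun_prop

theorem hasCompactSupport_grad {f : EuclideanSpace ℝ (Fin n) → ℂ} (hf : HasCompactSupport f) :
    HasCompactSupport (grad f) := by
  refine (hf.fderiv (𝕜 := ℝ)).mono fun x hx => ?_
  contrapose! hx
  simp only [Function.mem_support, ne_eq, not_not] at hx ⊢
  ext i
  simp [grad, hx]

/-- Test functions belong to `D¹`. -/
theorem hasD1Gradient_of_contDiff {f : EuclideanSpace ℝ (Fin n) → ℂ} (hf : ContDiff ℝ ∞ f)
    (hs : HasCompactSupport f) : HasD1Gradient f (grad f) where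
  memLp := hf.continuous.memLp_of_hasCompactSupport hs
  memLp_gradient := (continuous_grad hf).memLp_of_hasCompactSupport (hasCompactSupport_grad hs)
  exists_approx := ⟨fun _ => f, fun _ => ⟨hf, hs⟩, by simp, by simp⟩

/-- The integral of a directional derivative of a compactly supported function vanishes. -/
theorem integral_fderiv_apply_eq_zero {g : EuclideanSpace ℝ (Fin n) → ℝ} (hg : ContDiff ℝ 1 g)
    (hs : HasCompactSupport g) (v : EuclideanSpace ℝ (Fin n)) : ∫ x, fderiv ℝ g x v = 0 := by
  have hc : Continuous fun x => fderiv ℝ g x v := by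
    have := hg.continuous_fderiv one_ne_zero
    fun_prop
  have hi : Integrable fun x => fderiv ℝ g x v :=
    hc.integrable_of_hasCompactSupport (hs.fderiv_apply (𝕜 := ℝ) v)
  have := integral_mul_fderiv_eq_neg_fderiv_mul_of_integrable (μ := volume)
    (f := fun _ : EuclideanSpace ℝ (Fin n) => (1 : ℝ)) (g := g) (v := v)
    (by simp) (by simpa using hi)
    (by simpa using hg.continuous.integrable_of_hasCompactSupport hs)
    (fun x _ => by fun_prop) (fun x _ => hg.differentiable one_ne_zero x)
  simpa using this

/-! ### Hardy inequalities with respect to a point or a line -/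

/-- The squared distance of `x` to the line spanned by `b`, if `b` is a unit vector, and `‖x‖²`
if `b = 0`. -/
def perpSq (b x : EuclideanSpace ℝ (Fin n)) : ℝ := ‖x‖ ^ 2 - inner ℝ b x ^ 2

theorem sum_mul_eq_inner (b x : EuclideanSpace ℝ (Fin n)) : ∑ i, b i * x i = inner ℝ b x := by
  simp [PiLp.inner_apply, mul_comm]

theorem sum_sq_eq_norm_sq (x : EuclideanSpace ℝ (Fin n)) : ∑ i, x i ^ 2 = ‖x‖ ^ 2 := by
  simp [EuclideanSpace.norm_sq_eq]

theorem perpSq_nonneg {b : EuclideanSpace ℝ (Fin n)} (hb : ‖b‖ ≤ 1)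
    (x : EuclideanSpace ℝ (Fin n)) : 0 ≤ perpSq b x := by
  have h := abs_real_inner_le_norm b x
  have h2 : ‖b‖ * ‖x‖ ≤ 1 * ‖x‖ := by gcongr
  have := sq_le_sq' (by linarith [neg_abs_le (inner ℝ b x), norm_nonneg x])
    ((le_abs_self _).trans (h.trans (h2.trans_eq (one_mul _))))
  unfold perpSq
  linarith

theorem sum_perp_sq {b : EuclideanSpace ℝ (Fin n)} (hb : b = 0 ∨ ‖b‖ = 1)
    (x : EuclideanSpace ℝ (Fin n)) :
    ∑ i, (x i - inner ℝ b x * b i) ^ 2 = perpSq b x := by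
  have : ∀ i, (x i - inner ℝ b x * b i) ^ 2 =
      x i ^ 2 - 2 * inner ℝ b x * (b i * x i) + inner ℝ b x ^ 2 * b i ^ 2 := fun i => by ring
  simp only [this, Finset.sum_add_distrib, Finset.sum_sub_distrib, ← Finset.mul_sum,
    sum_mul_eq_inner, sum_sq_eq_norm_sq, perpSq]
  rcases hb with rfl | hb
  · simp
  · rw [hb]; ring

theorem contDiff_perpSq (b : EuclideanSpace ℝ (Fin n)) {m : WithTop ℕ∞} :
    ContDiff ℝ m (perpSq b) := by
  unfold perpSq
  exact (contDiff_id.norm_sq ℝ).sub ((contDiff_const.inner ℝ contDiff_id).pow 2)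

/-- The regularized Hardy vector field. -/
def hardyField (b : EuclideanSpace ℝ (Fin n)) (ε : ℝ) (i : Fin n)
    (x : EuclideanSpace ℝ (Fin n)) : ℝ :=
  (x i - inner ℝ b x * b i) * (perpSq b x + ε)⁻¹

theorem contDiff_hardyField {b : EuclideanSpace ℝ (Fin n)} (hb : ‖b‖ ≤ 1) {ε : ℝ} (hε : 0 < ε)
    (i : Fin n) : ContDiff ℝ 1 (hardyField b ε i) := by
  unfold hardyField
  refine ContDiff.mul ?_ (((contDiff_perpSq b).add contDiff_const).inv fun x => ?_)
  · have : ContDiff ℝ 1 fun x : EuclideanSpace ℝ (Fin n) => x i :=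
      (EuclideanSpace.proj (𝕜 := ℝ) i).contDiff
    exact this.sub ((contDiff_const.inner ℝ contDiff_id).mul contDiff_const)
  · have := perpSq_nonneg hb x
    positivity

theorem hasFDerivAt_perpSq (b x : EuclideanSpace ℝ (Fin n)) :
    HasFDerivAt (perpSq b) (2 • innerSL ℝ x - (2 * inner ℝ b x) • innerSL ℝ b) x := by
  unfold perpSq
  have h1 := (hasStrictFDerivAt_norm_sq x).hasFDerivAt
  have h2 := ((innerSL ℝ b).hasFDerivAt (x := x)).pow 2
  convert! h1.sub h2 using 1
  ext v
  simp

theorem fderiv_hardyField {b : EuclideanSpace ℝ (Fin n)} (hb : ‖b‖ ≤ 1) {ε : ℝ} (hε : 0 < ε)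
    (i : Fin n) (x : EuclideanSpace ℝ (Fin n)) :
    fderiv ℝ (hardyField b ε i) x (EuclideanSpace.single i (1 : ℝ)) =
      (1 - b i ^ 2) * (perpSq b x + ε)⁻¹
        - 2 * (x i - inner ℝ b x * b i) ^ 2 * ((perpSq b x + ε)⁻¹) ^ 2 := by
  have hp : perpSq b x + ε ≠ 0 := by
    have := perpSq_nonneg hb x
    positivity
  have h1 : HasFDerivAt (fun x : EuclideanSpace ℝ (Fin n) => x i - inner ℝ b x * b i)
      (EuclideanSpace.proj (𝕜 := ℝ) i - b i • innerSL ℝ b) x :=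
    (EuclideanSpace.proj (𝕜 := ℝ) i).hasFDerivAt.sub
      (((innerSL ℝ b).hasFDerivAt (x := x)).mul_const (b i))
  have h2 : HasFDerivAt (fun x => (perpSq b x + ε)⁻¹) _ x :=
    (hasDerivAt_inv hp).comp_hasFDerivAt x ((hasFDerivAt_perpSq b x).add_const ε)
  have := (h1.fun_mul h2).fderiv
  unfold hardyField
  rw [this]
  simp [EuclideanSpace.inner_single_right]
  field_simp
  ring

/-- This is the divergence of the field. The factor `n - ‖b‖ ^ 2` is the dimension of the orthogonal
complement of `b`, so `b = 0` and `‖b‖ = 1` are handled at once. -/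
theorem sum_fderiv_hardyField {b : EuclideanSpace ℝ (Fin n)} (hb : b = 0 ∨ ‖b‖ = 1) {ε : ℝ}
    (hε : 0 < ε) (x : EuclideanSpace ℝ (Fin n)) :
    ∑ i, fderiv ℝ (hardyField b ε i) x (EuclideanSpace.single i (1 : ℝ)) =
      (n - ‖b‖ ^ 2) * (perpSq b x + ε)⁻¹ - 2 * perpSq b x * ((perpSq b x + ε)⁻¹) ^ 2 := by
  have hb' : ‖b‖ ≤ 1 := by rcases hb with rfl | h <;> simp [*]
  simp only [fderiv_hardyField hb' hε, Finset.sum_sub_distrib, ← Finset.sum_mul,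
    ← Finset.mul_sum, sum_perp_sq hb, sum_sq_eq_norm_sq]
  simp

theorem fderiv_norm_sq_apply {f : EuclideanSpace ℝ (Fin n) → ℂ} {x : EuclideanSpace ℝ (Fin n)}
    (hf : DifferentiableAt ℝ f x) (v : EuclideanSpace ℝ (Fin n)) :
    fderiv ℝ (fun y => ‖f y‖ ^ 2) x v = 2 * inner ℝ (f x) (fderiv ℝ f x v) := by
  rw [(hf.hasFDerivAt.norm_sq).fderiv]
  simp [mul_add]

/-- The pointwise inequality behind the Hardy inequality. -/
theorem hardy_pointwise {b : EuclideanSpace ℝ (Fin n)} (hb : b = 0 ∨ ‖b‖ = 1) {ε : ℝ}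
    (hε : 0 < ε) {a : ℝ} (ha : 0 ≤ a) (hab : 2 * a + 2 = n - ‖b‖ ^ 2)
    {f : EuclideanSpace ℝ (Fin n) → ℂ} (hf : ContDiff ℝ ∞ f) (x : EuclideanSpace ℝ (Fin n)) :
    a ^ 2 * ((perpSq b x + ε)⁻¹ * ‖f x‖ ^ 2) ≤ ‖grad f x‖ ^ 2 +
      a * ∑ i, fderiv ℝ (fun y => hardyField b ε i y * ‖f y‖ ^ 2) x
        (EuclideanSpace.single i (1 : ℝ)) := by
  have hb' : ‖b‖ ≤ 1 := by rcases hb with rfl | h <;> simp [*]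
  have hfd : DifferentiableAt ℝ f x := hf.differentiable (by simp) x
  have hprod : ∀ i, fderiv ℝ (fun y => hardyField b ε i y * ‖f y‖ ^ 2) x
        (EuclideanSpace.single i (1 : ℝ)) =
      fderiv ℝ (hardyField b ε i) x (EuclideanSpace.single i (1 : ℝ)) * ‖f x‖ ^ 2 +
      2 * inner ℝ (hardyField b ε i x • f x)
        (fderiv ℝ f x (EuclideanSpace.single i (1 : ℝ))) := by
    intro i
    have h1 := ((contDiff_hardyField hb' hε i).differentiable one_ne_zero x).hasFDerivAt
    rw [(h1.fun_mul (hfd.norm_sq ℝ).hasFDerivAt).fderiv]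
    simp [fderiv_norm_sq_apply hfd]
    ring
  -- Expand `|∂ᵢf + a Fᵢ f|² ≥ 0` with `F` the Hardy field; the cross term is the part of `a
  -- div(F|f|²)` that differentiates `|f|²`.
  have hsq : ∀ i, 0 ≤ ‖fderiv ℝ f x (EuclideanSpace.single i (1 : ℝ))‖ ^ 2
      + 2 * a * inner ℝ (hardyField b ε i x • f x)
        (fderiv ℝ f x (EuclideanSpace.single i (1 : ℝ)))
      + a ^ 2 * (hardyField b ε i x ^ 2 * ‖f x‖ ^ 2) := by
    intro i
    have := norm_add_sq_real (a • hardyField b ε i x • f x)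
      (fderiv ℝ f x (EuclideanSpace.single i (1 : ℝ)))
    rw [real_inner_smul_left, norm_smul, norm_smul] at this
    have h2 := sq_nonneg ‖a • hardyField b ε i x • f x +
      (fderiv ℝ f x (EuclideanSpace.single i (1 : ℝ)))‖
    rw [this] at h2
    simp only [mul_pow, Real.norm_eq_abs, sq_abs] at h2
    linarith
  have hsum := Finset.sum_nonneg fun i (_ : i ∈ Finset.univ) => hsq i
  have hF : ∑ i, hardyField b ε i x ^ 2 = perpSq b x * ((perpSq b x + ε)⁻¹) ^ 2 := by
    simp only [hardyField, mul_pow, ← Finset.sum_mul, sum_perp_sq hb]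
  simp only [hprod, Finset.sum_add_distrib, ← Finset.sum_mul, ← Finset.mul_sum,
    sum_fderiv_hardyField hb hε, ← norm_grad_sq, hF] at hsum ⊢
  have hq := perpSq_nonneg hb' x
  have hw : perpSq b x * (perpSq b x + ε)⁻¹ ≤ 1 := by
    rw [← div_eq_mul_inv, div_le_one (by positivity)]
    linarith
  have hw0 : 0 ≤ (perpSq b x + ε)⁻¹ := by positivity
  rw [← hab]
  set w := (perpSq b x + ε)⁻¹
  set q := perpSq b x
  -- This is exactly the slack left by the regularization; it would vanish at `ε = 0`, where `q * w
  -- = 1`.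
  have key : 0 ≤ (2 * a + a ^ 2) * ‖f x‖ ^ 2 * w * (1 - q * w) :=
    mul_nonneg (by positivity) (by linarith)
  nlinarith [key, hsum]

theorem integrable_norm_grad_sq {f : EuclideanSpace ℝ (Fin n) → ℂ} (hf : ContDiff ℝ ∞ f)
    (hs : HasCompactSupport f) : Integrable fun x => ‖grad f x‖ ^ 2 :=
  (memLp_two_iff_integrable_sq_norm (continuous_grad hf).aestronglyMeasurable).1
    (hasD1Gradient_of_contDiff hf hs).memLp_gradient

theorem hasCompactSupport_norm_sq {f : EuclideanSpace ℝ (Fin n) → ℂ}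
    (hs : HasCompactSupport f) : HasCompactSupport fun x => ‖f x‖ ^ 2 :=
  hs.mono fun x hx => by
    contrapose! hx
    simp only [Function.mem_support, ne_eq, not_not] at hx ⊢
    simp [hx]

/-- The divergence of a compactly supported vector field has vanishing integral. -/
theorem integral_sum_fderiv_eq_zero {g : Fin n → EuclideanSpace ℝ (Fin n) → ℝ}
    (hg : ∀ i, ContDiff ℝ 1 (g i)) (hs : ∀ i, HasCompactSupport (g i)) :
    Integrable (fun x => ∑ i, fderiv ℝ (g i) x (EuclideanSpace.single i (1 : ℝ))) ∧
      ∫ x, ∑ i, fderiv ℝ (g i) x (EuclideanSpace.single i (1 : ℝ)) = 0 := by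
  have hi : ∀ i, Integrable fun x => fderiv ℝ (g i) x (EuclideanSpace.single i (1 : ℝ)) := by
    intro i
    refine Continuous.integrable_of_hasCompactSupport ?_ ((hs i).fderiv_apply (𝕜 := ℝ) _)
    have := (hg i).continuous_fderiv one_ne_zero
    fun_prop
  refine ⟨integrable_finsetSum _ fun i _ => hi i, ?_⟩
  rw [integral_finsetSum _ fun i _ => hi i]
  exact Finset.sum_eq_zero fun i _ => integral_fderiv_apply_eq_zero (hg i) (hs i) _

theorem integrable_regularized_weight {b : EuclideanSpace ℝ (Fin n)} (hb : ‖b‖ ≤ 1) {ε : ℝ}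
    (hε : 0 < ε) {f : EuclideanSpace ℝ (Fin n) → ℂ} (hf : ContDiff ℝ ∞ f)
    (hs : HasCompactSupport f) : Integrable fun x => (perpSq b x + ε)⁻¹ * ‖f x‖ ^ 2 := by
  refine Continuous.integrable_of_hasCompactSupport ?_ (hasCompactSupport_norm_sq hs).mul_left
  refine Continuous.mul (Continuous.inv₀ ?_ fun x => ?_) (hf.continuous.norm.pow 2)
  · exact (contDiff_perpSq (m := 0) b).continuous.add continuous_const
  · have := perpSq_nonneg hb x
    positivity

/-- The Hardy inequality with respect to the distance to a line or to the origin, for test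
functions and with regularized weight. -/
theorem hardy_test {b : EuclideanSpace ℝ (Fin n)} (hb : b = 0 ∨ ‖b‖ = 1) {ε : ℝ}
    (hε : 0 < ε) {a : ℝ} (ha : 0 ≤ a) (hab : 2 * a + 2 = n - ‖b‖ ^ 2)
    {f : EuclideanSpace ℝ (Fin n) → ℂ} (hf : ContDiff ℝ ∞ f) (hs : HasCompactSupport f) :
    a ^ 2 * ∫ x, (perpSq b x + ε)⁻¹ * ‖f x‖ ^ 2 ≤ ∫ x, ‖grad f x‖ ^ 2 := by
  have hb' : ‖b‖ ≤ 1 := by rcases hb with rfl | h <;> simp [*]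
  have hf2 : ContDiff ℝ 1 fun x => ‖f x‖ ^ 2 := (hf.norm_sq ℝ).of_le (by norm_cast)
  obtain ⟨hsum, h0⟩ := integral_sum_fderiv_eq_zero
    (g := fun i y => hardyField b ε i y * ‖f y‖ ^ 2)
    (fun i => (contDiff_hardyField hb' hε i).mul hf2)
    (fun i => (hasCompactSupport_norm_sq hs).mul_left)
  have hG := integrable_norm_grad_sq hf hs
  have hmono := integral_mono_of_nonneg
    (Eventually.of_forall fun x => mul_nonneg (sq_nonneg a) (mul_nonneg
      (inv_nonneg.2 (add_nonneg (perpSq_nonneg hb' x) hε.le)) (sq_nonneg ‖f x‖)))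
    (hG.add (hsum.const_mul a))
    (Eventually.of_forall fun x => hardy_pointwise hb hε ha hab hf x)
  rw [integral_const_mul] at hmono
  refine hmono.trans_eq ?_
  rw [integral_add' hG (hsum.const_mul a), integral_const_mul, h0, mul_zero, add_zero]

/-- The exceptional points lie on the span of `b`, a proper subspace in dimension at least two,
hence a null set. -/
theorem ae_perpSq_pos (hn : 2 ≤ n) {b : EuclideanSpace ℝ (Fin n)} (hb : b = 0 ∨ ‖b‖ = 1) :
    ∀ᵐ x, 0 < perpSq b x := by
  have hb' : ‖b‖ ≤ 1 := by rcases hb with rfl | h <;> simp [*]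
  have hne : Submodule.span ℝ {b} ≠ ⊤ := by
    intro h
    have h1 := finrank_span_le_card (R := ℝ) {b}
    rw [h, finrank_top, finrank_euclideanSpace_fin] at h1
    simp at h1
    omega
  refine measure_mono_null (fun x hx => ?_) (Measure.addHaar_submodule volume _ hne)
  have hx0 : perpSq b x = 0 :=
    le_antisymm (not_lt.1 hx) (perpSq_nonneg hb' x)
  rw [← sum_perp_sq hb, Finset.sum_eq_zero_iff_of_nonneg fun i _ => sq_nonneg _] at hx0
  refine Submodule.mem_span_singleton.2 ⟨inner ℝ b x, ?_⟩
  ext i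
  have := pow_eq_zero_iff two_ne_zero |>.1 (hx0 i (Finset.mem_univ i))
  simp only [PiLp.smul_apply, smul_eq_mul]
  linarith

theorem eLpNorm_two_sq {E F : Type*} [MeasurableSpace E] [NormedAddCommGroup F] (μ : Measure E)
    (g : E → F) : eLpNorm g 2 μ ^ 2 = ∫⁻ x, ‖g x‖ₑ ^ 2 ∂μ := by
  have := eLpNorm_nnreal_pow_eq_lintegral (f := g) (μ := μ) (p := 2) two_ne_zero
  simpa using this

theorem lintegral_enorm_sq_eq_ofReal {F : Type*} [NormedAddCommGroup F]
    {g : EuclideanSpace ℝ (Fin n) → F} (hg : Integrable fun x => ‖g x‖ ^ 2) :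
    ∫⁻ x, ‖g x‖ₑ ^ 2 = ENNReal.ofReal (∫ x, ‖g x‖ ^ 2) := by
  rw [ofReal_integral_eq_lintegral_ofReal hg (Eventually.of_forall fun x => by positivity)]
  congr with x
  rw [ENNReal.ofReal_pow (norm_nonneg _), ofReal_norm]

theorem hardy_test_lintegral {b : EuclideanSpace ℝ (Fin n)} (hb : b = 0 ∨ ‖b‖ = 1) {ε : ℝ}
    (hε : 0 < ε) {a : ℝ} (ha : 0 < a) (hab : 2 * a + 2 = n - ‖b‖ ^ 2)
    {f : EuclideanSpace ℝ (Fin n) → ℂ} (hf : ContDiff ℝ ∞ f) (hs : HasCompactSupport f) :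
    ∫⁻ x, ENNReal.ofReal ((perpSq b x + ε)⁻¹ * ‖f x‖ ^ 2) ≤
      ENNReal.ofReal (a ^ 2)⁻¹ * eLpNorm (grad f) 2 volume ^ 2 := by
  have hb' : ‖b‖ ≤ 1 := by rcases hb with rfl | h <;> simp [*]
  rw [eLpNorm_two_sq, lintegral_enorm_sq_eq_ofReal (integrable_norm_grad_sq hf hs),
    ← ofReal_integral_eq_lintegral_ofReal (integrable_regularized_weight hb' hε hf hs)
      (Eventually.of_forall fun x => mul_nonneg
      (inv_nonneg.2 (add_nonneg (perpSq_nonneg hb' x) hε.le)) (sq_nonneg ‖f x‖)),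
    ← ENNReal.ofReal_mul (by positivity)]
  refine ENNReal.ofReal_le_ofReal ?_
  rw [inv_mul_eq_div, le_div_iff₀ (by positivity), mul_comm]
  exact hardy_test hb hε ha.le hab hf hs

/-- The Hardy inequality on `D¹`. -/
theorem HasD1Gradient.hardy (hn : 3 ≤ n) {b : EuclideanSpace ℝ (Fin n)} (hb : b = 0 ∨ ‖b‖ = 1)
    {a : ℝ} (ha : 0 < a) (hab : 2 * a + 2 = n - ‖b‖ ^ 2)
    {f : EuclideanSpace ℝ (Fin n) → ℂ} {G : EuclideanSpace ℝ (Fin n) → EuclideanSpace ℂ (Fin n)}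
    (h : HasD1Gradient f G) :
    ∫⁻ x, ENNReal.ofReal ((perpSq b x)⁻¹ * ‖f x‖ ^ 2) ≤
      ENNReal.ofReal (a ^ 2)⁻¹ * ENNReal.ofReal (∫ x, ‖G x‖ ^ 2) := by
  obtain ⟨φ, hφ, hφf, hφG⟩ := h.exists_approx
  have hp : sobolevExponent n ≠ 0 := by
    have : (3 : ℝ) ≤ n := by exact_mod_cast hn
    have : (0 : ℝ) < 2 * n / (n - 2) := div_pos (by linarith) (by linarith)
    simpa [sobolevExponent] using this
  -- A subsequence of the approximating test functions converges almost everywhere. Tying `ε = 1 /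
  -- (j + 1)` to its index lets one application of Fatou's lemma remove both the smoothing of the
  -- weight and the approximation of `f`.
  obtain ⟨ns, hns, hae⟩ := (tendstoInMeasure_of_tendsto_eLpNorm hp
    (fun j => (hφ j).1.continuous.aestronglyMeasurable) h.memLp.1 hφf).exists_seq_tendsto_ae
  have hε : Tendsto (fun j : ℕ => 1 / ((j : ℝ) + 1)) atTop (𝓝 0) :=
    tendsto_one_div_add_atTop_nhds_zero_nat
  have hlim : ∀ᵐ x, ENNReal.ofReal ((perpSq b x)⁻¹ * ‖f x‖ ^ 2) =
      liminf (fun j : ℕ => ENNReal.ofReal ((perpSq b x + 1 / ((j : ℝ) + 1))⁻¹ *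
        ‖φ (ns j) x‖ ^ 2)) atTop := by
    filter_upwards [hae, ae_perpSq_pos (by omega) hb] with x hx hq
    refine (Tendsto.liminf_eq ?_).symm
    refine ENNReal.tendsto_ofReal (Tendsto.mul ?_ (hx.norm.pow 2))
    simpa using (hε.const_add (perpSq b x)).inv₀ (by simpa using hq.ne')
  have hGsq : Integrable fun x => ‖G x‖ ^ 2 :=
    (memLp_two_iff_integrable_sq_norm h.memLp_gradient.1).1 h.memLp_gradient
  have hbound : Tendsto (fun j => ENNReal.ofReal (a ^ 2)⁻¹ *
      (eLpNorm (grad (φ (ns j)) - G) 2 volume + eLpNorm G 2 volume) ^ 2) atTop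
      (𝓝 (ENNReal.ofReal (a ^ 2)⁻¹ * ENNReal.ofReal (∫ x, ‖G x‖ ^ 2))) := by
    rw [← lintegral_enorm_sq_eq_ofReal hGsq, ← eLpNorm_two_sq]
    have h1 : Tendsto (fun j => eLpNorm (grad (φ (ns j)) - G) 2 volume + eLpNorm G 2 volume)
        atTop (𝓝 (0 + eLpNorm G 2 volume)) :=
      (hφG.comp hns.tendsto_atTop).add tendsto_const_nhds
    rw [zero_add] at h1
    exact ENNReal.Tendsto.const_mul (ENNReal.Tendsto.pow h1) (Or.inr ENNReal.ofReal_ne_top)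
  rw [lintegral_congr_ae hlim]
  refine (lintegral_liminf_le fun j => ?_).trans ?_
  · refine ENNReal.measurable_ofReal.comp (Measurable.mul ?_ ?_)
    · exact ((contDiff_perpSq (m := 0) b).continuous.measurable.add_const _).inv
    · exact ((hφ (ns j)).1.continuous.norm.pow 2).measurable
  · rw [← hbound.liminf_eq]
    refine liminf_le_liminf (Eventually.of_forall fun j => ?_)
    refine (hardy_test_lintegral hb (by positivity) ha hab (hφ _).1 (hφ _).2).trans ?_
    gcongr
    have h2 := eLpNorm_add_le (p := 2) (μ := volume)
      (((continuous_grad (hφ (ns j)).1).aestronglyMeasurable).sub h.memLp_gradient.1)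
      h.memLp_gradient.1 (by norm_num)
    simpa using h2

theorem measurable_dipole (u : EuclideanSpace ℝ (Fin n)) :
    Measurable fun x : EuclideanSpace ℝ (Fin n) => inner ℝ u x / ‖x‖ ^ 3 := by
  fun_prop

/-- A pointwise bound of the dipole potential by a Hardy weight gives a dipole Hardy inequality. -/
theorem HasD1Gradient.dipole (hn : 3 ≤ n) {b u : EuclideanSpace ℝ (Fin n)}
    (hb : b = 0 ∨ ‖b‖ = 1) {a κ γ : ℝ} (ha : 0 < a) (hab : 2 * a + 2 = n - ‖b‖ ^ 2)
    (hκ : 0 ≤ κ) (hV : ∀ x, 0 < perpSq b x → |inner ℝ u x / ‖x‖ ^ 3| ≤ κ * (perpSq b x)⁻¹)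
    (hγ : 0 ≤ γ) (hγκ : γ * κ ≤ a ^ 2)
    {f : EuclideanSpace ℝ (Fin n) → ℂ} {G : EuclideanSpace ℝ (Fin n) → EuclideanSpace ℂ (Fin n)}
    (h : HasD1Gradient f G) :
    Integrable (fun x => inner ℝ u x / ‖x‖ ^ 3 * ‖f x‖ ^ 2) volume ∧
    γ * |∫ x, inner ℝ u x / ‖x‖ ^ 3 * ‖f x‖ ^ 2| ≤ ∫ x, ‖G x‖ ^ 2 := by
  set K := ∫ x, ‖G x‖ ^ 2
  have hK : 0 ≤ K := integral_nonneg fun x => sq_nonneg _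
  have hle : ∫⁻ x, ‖inner ℝ u x / ‖x‖ ^ 3 * ‖f x‖ ^ 2‖ₑ ≤ ENNReal.ofReal (κ * ((a ^ 2)⁻¹ * K)) := by
    calc ∫⁻ x, ‖inner ℝ u x / ‖x‖ ^ 3 * ‖f x‖ ^ 2‖ₑ
        ≤ ∫⁻ x, ENNReal.ofReal κ * ENNReal.ofReal ((perpSq b x)⁻¹ * ‖f x‖ ^ 2) := by
          refine lintegral_mono_ae ?_
          filter_upwards [ae_perpSq_pos (by omega) hb] with x hx
          rw [← ENNReal.ofReal_mul hκ, ← ofReal_norm, norm_mul, norm_pow, norm_norm,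
            ← mul_assoc]
          exact ENNReal.ofReal_le_ofReal (mul_le_mul_of_nonneg_right (hV x hx) (sq_nonneg _))
      _ = ENNReal.ofReal κ * ∫⁻ x, ENNReal.ofReal ((perpSq b x)⁻¹ * ‖f x‖ ^ 2) :=
          lintegral_const_mul' _ _ ENNReal.ofReal_ne_top
      _ ≤ ENNReal.ofReal κ * (ENNReal.ofReal (a ^ 2)⁻¹ * ENNReal.ofReal K) := by
          gcongr
          exact h.hardy hn hb ha hab
      _ = _ := by rw [ENNReal.ofReal_mul hκ, ENNReal.ofReal_mul (by positivity)]
  have h_int : Integrable (fun x => inner ℝ u x / ‖x‖ ^ 3 * ‖f x‖ ^ 2) volume :=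
    ⟨(measurable_dipole u).aestronglyMeasurable.mul (h.memLp.1.norm.pow 2),
      hle.trans_lt ENNReal.ofReal_lt_top⟩
  refine ⟨h_int, ?_⟩
  have h1 : |∫ x, inner ℝ u x / ‖x‖ ^ 3 * ‖f x‖ ^ 2| ≤ κ * ((a ^ 2)⁻¹ * K) := by
    rw [← ENNReal.ofReal_le_ofReal_iff (by positivity)]
    refine le_trans ?_ hle
    rw [← Real.norm_eq_abs, ofReal_norm]
    exact enorm_integral_le_lintegral_enorm _
  calc γ * |∫ x, inner ℝ u x / ‖x‖ ^ 3 * ‖f x‖ ^ 2| ≤ γ * (κ * ((a ^ 2)⁻¹ * K)) := by gcongr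
    _ = (γ * κ) * ((a ^ 2)⁻¹ * K) := by ring
    _ ≤ a ^ 2 * ((a ^ 2)⁻¹ * K) := by gcongr
    _ = K := by field_simp

/-! ### Lower bounds and existence of the largest constant -/

theorem dipoleHardy_of_abs {γ : ℝ} (hγ : 0 ≤ γ) (h : ∀ u : EuclideanSpace ℝ (Fin n), ‖u‖ = 1 →
    ∀ (f : EuclideanSpace ℝ (Fin n) → ℂ)
      (G : EuclideanSpace ℝ (Fin n) → EuclideanSpace ℂ (Fin n)), HasD1Gradient f G →
    Integrable (fun x => inner ℝ u x / ‖x‖ ^ 3 * ‖f x‖ ^ 2) volume ∧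
    γ * |∫ x, inner ℝ u x / ‖x‖ ^ 3 * ‖f x‖ ^ 2| ≤ ∫ x, ‖G x‖ ^ 2) : DipoleHardy n γ := by
  intro u hu f G hG
  obtain ⟨h1, h2⟩ := h u hu f G hG
  refine ⟨h1, ?_, ?_⟩
  · exact (mul_le_mul_of_nonneg_left (le_abs_self _) hγ).trans h2
  · have := mul_le_mul_of_nonneg_left (neg_le_abs
      (∫ x, inner ℝ u x / ‖x‖ ^ 3 * ‖f x‖ ^ 2)) hγ
    linarith

theorem dipoleHardy_of_le_sq (hn : 3 ≤ n) {γ : ℝ} (hγ : 0 ≤ γ)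
    (h : γ ≤ (((n : ℝ) - 2) / 2) ^ 2) : DipoleHardy n γ := by
  have hn' : (3 : ℝ) ≤ n := by exact_mod_cast hn
  refine dipoleHardy_of_abs hγ fun u hu f G hG => hG.dipole hn (b := 0) (κ := 1)
    (a := ((n : ℝ) - 2) / 2) (Or.inl rfl) (by linarith) (by simp; ring) zero_le_one (fun x hx => ?_) hγ
    (by simpa using h)
  have h1 := abs_real_inner_le_norm u x
  have hx' : 0 < ‖x‖ := by
    rcases (norm_nonneg x).eq_or_lt with h0 | h0
    · simp [perpSq, ← h0] at hx
    · exact h0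
  rw [hu, one_mul] at h1
  simp only [perpSq, inner_zero_left, one_mul]
  rw [abs_div, abs_of_pos (by positivity : 0 < ‖x‖ ^ 3), div_le_iff₀ (by positivity)]
  refine h1.trans_eq ?_
  field_simp
  ring

/-- The maximum of `cos θ sin² θ` is `2 / (3 √3)`. -/
theorem dipole_le_perp_weight {u x : EuclideanSpace ℝ (Fin n)} (hx : 0 < perpSq u x) :
    |inner ℝ u x / ‖x‖ ^ 3| ≤ 2 / (3 * √3) * (perpSq u x)⁻¹ := by
  have hx' : 0 < ‖x‖ := by
    rcases (norm_nonneg x).eq_or_lt with h0 | h0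
    · simp only [perpSq, ← h0] at hx
      nlinarith [sq_nonneg (inner ℝ u x)]
    · exact h0
  rw [abs_div, abs_of_pos (by positivity : 0 < ‖x‖ ^ 3), div_le_iff₀ (by positivity),
    mul_assoc, ← div_eq_inv_mul, div_mul_div_comm, le_div_iff₀ (by positivity)]
  have h3 : √3 ^ 2 = 3 := Real.sq_sqrt (by norm_num)
  have hs : inner ℝ u x ^ 2 = |inner ℝ u x| ^ 2 := (sq_abs _).symm
  simp only [perpSq, hs]
  set s := |inner ℝ u x|
  have hs0 : 0 ≤ s := abs_nonneg _
  have hr3 : 0 ≤ √3 := Real.sqrt_nonneg 3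
  -- With `s = |x| |cos θ|`, the cubic `2|x|³ - 3√3 s(|x|² - s²)` has a double root at the maximizer
  -- `|cos θ| = 1/√3`, hence this factorization.
  have key : 0 ≤ (√3 * s - ‖x‖) ^ 2 * (√3 * s + 2 * ‖x‖) := by positivity
  have h33 : √3 ^ 3 = 3 * √3 := by rw [pow_succ, h3]
  have e : (√3 * s - ‖x‖) ^ 2 * (√3 * s + 2 * ‖x‖) =
      √3 ^ 3 * s ^ 3 - 3 * √3 * s * ‖x‖ ^ 2 + 2 * ‖x‖ ^ 3 := by ring
  rw [e, h33] at key
  linarith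

/-- The Hardy weight is that of the dipole axis, `b = u`. The complement of the axis has dimension
`n - 1`, so `a = (n - 3) / 2`, which is positive only from `n = 4` on. -/
theorem dipoleHardy_of_le_perp (hn : 4 ≤ n) {γ : ℝ} (hγ : 0 ≤ γ)
    (h : γ ≤ 3 * √3 / 8 * ((n : ℝ) - 3) ^ 2) : DipoleHardy n γ := by
  have hn' : (4 : ℝ) ≤ n := by exact_mod_cast hn
  refine dipoleHardy_of_abs hγ fun u hu f G hG => hG.dipole (by omega) (b := u)
    (κ := 2 / (3 * √3)) (a := ((n : ℝ) - 3) / 2) (Or.inr hu) (by linarith) (by rw [hu]; ring)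
    (by positivity) (fun x hx => dipole_le_perp_weight hx) hγ ?_
  rw [mul_div_assoc', div_le_iff₀ (by positivity)]
  linarith

/-- The inequalities are linear in the coupling and the gradient integral bounds both signs, so
validity at `c` implies validity on all of `[0, c]`. -/
theorem mem_admissibleConstants_iff {c : ℝ} :
    c ∈ admissibleConstants n ↔ 0 ≤ c ∧ DipoleHardy n c := by
  refine ⟨fun h => ⟨h.1, h.2 c ⟨h.1, le_rfl⟩⟩, fun h => ⟨h.1, fun γ hγ u hu f G hG => ?_⟩⟩
  obtain ⟨h1, h2, h3⟩ := h.2 u hu f G hG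
  refine ⟨h1, ?_, ?_⟩ <;>
  rcases le_total 0 (∫ x, inner ℝ u x / ‖x‖ ^ 3 * ‖f x‖ ^ 2) with hI | hI <;>
  nlinarith [hγ.1, hγ.2]

/-- For each `u` and `f`, integrability does not involve `γ`, and the two inequalities are closed
conditions on it. -/
theorem isClosed_dipoleHardy : IsClosed {γ : ℝ | DipoleHardy n γ} := by
  simp only [DipoleHardy, Set.ofPred_forall]
  refine isClosed_iInter fun u => isClosed_iInter fun hu => isClosed_iInter fun f =>
    isClosed_iInter fun G => isClosed_iInter fun hG => ?_
  simp only [Set.ofPred_and]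
  exact isClosed_const.inter
    ((isClosed_le (by fun_prop) continuous_const).inter
      (isClosed_le (by fun_prop) continuous_const))

/-- The set of admissible constants has a largest element as soon as it is bounded. -/
theorem isGreatest_criticalConstant (hn : 3 ≤ n) (hb : BddAbove (admissibleConstants n)) :
    IsGreatest (admissibleConstants n) (criticalConstant n) := by
  have h0 : (0 : ℝ) ∈ admissibleConstants n :=
    mem_admissibleConstants_iff.2 ⟨le_rfl, dipoleHardy_of_le_sq hn le_rfl (sq_nonneg _)⟩
  have hc : IsClosed (admissibleConstants n) := by
    have : admissibleConstants n = Set.Ici 0 ∩ {γ | DipoleHardy n γ} := by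
      ext c
      exact mem_admissibleConstants_iff
    rw [this]
    exact isClosed_Ici.inter isClosed_dipoleHardy
  exact ⟨hc.csSup_mem ⟨0, h0⟩ hb, fun c hc => le_csSup hb hc⟩

/-! ### Real trial functions and symmetries of integrals -/

theorem fderiv_ofReal_comp_apply {g : EuclideanSpace ℝ (Fin n) → ℝ}
    {x : EuclideanSpace ℝ (Fin n)} (hg : DifferentiableAt ℝ g x) (v : EuclideanSpace ℝ (Fin n)) :
    fderiv ℝ (fun y => (g y : ℂ)) x v = (fderiv ℝ g x v : ℂ) := by
  have := (Complex.ofRealCLM.hasFDerivAt.comp x hg.hasFDerivAt).fderiv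
  change fderiv ℝ (Complex.ofRealCLM ∘ g) x v = _
  rw [this]
  simp

/-- The dipole Hardy inequality for real test functions and a coordinate direction. -/
theorem DipoleHardy.real_test {γ : ℝ} (h : DipoleHardy n γ) (i₀ : Fin n)
    {g : EuclideanSpace ℝ (Fin n) → ℝ} (hg : ContDiff ℝ ∞ g) (hs : HasCompactSupport g) :
    Integrable (fun x : EuclideanSpace ℝ (Fin n) => x i₀ / ‖x‖ ^ 3 * g x ^ 2) ∧
    γ * ∫ x : EuclideanSpace ℝ (Fin n), x i₀ / ‖x‖ ^ 3 * g x ^ 2 ≤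
      ∫ x, ∑ i, fderiv ℝ g x (EuclideanSpace.single i (1 : ℝ)) ^ 2 := by
  have hf : ContDiff ℝ ∞ fun x => (g x : ℂ) := Complex.ofRealCLM.contDiff.comp hg
  have hfs : HasCompactSupport fun x => (g x : ℂ) :=
    hs.comp_left (g := fun t : ℝ => (t : ℂ)) (by simp)
  obtain ⟨h1, h2, -⟩ := h (EuclideanSpace.single i₀ 1) (by simp) _ _
    (hasD1Gradient_of_contDiff hf hfs)
  have hgr : ∀ x, ‖grad (fun x => (g x : ℂ)) x‖ ^ 2 =
      ∑ i, fderiv ℝ g x (EuclideanSpace.single i (1 : ℝ)) ^ 2 := by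
    intro x
    rw [norm_grad_sq]
    refine Finset.sum_congr rfl fun i _ => ?_
    rw [fderiv_ofReal_comp_apply (hg.differentiable (by simp) x), Complex.norm_real,
      Real.norm_eq_abs, sq_abs]
  simp only [hgr, Complex.norm_real, Real.norm_eq_abs, sq_abs,
    EuclideanSpace.inner_single_left, map_one, one_mul] at h1 h2
  exact ⟨h1, h2⟩

theorem integral_eq_zero_of_odd {g : EuclideanSpace ℝ (Fin n) → ℝ} (hg : ∀ x, g (-x) = -g x) :
    ∫ x, g x = 0 := by
  have h := integral_neg_eq_self g volume
  simp only [hg, integral_neg] at h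
  linarith

/-- Swapping two coordinates is an isometry, so all coordinates contribute equally to the radial
second moment. -/
theorem integral_mul_coord_sq {h : EuclideanSpace ℝ (Fin n) → ℝ}
    (hrad : ∀ x y, ‖x‖ = ‖y‖ → h x = h y)
    (hi : ∀ i, Integrable fun x : EuclideanSpace ℝ (Fin n) => h x * x i ^ 2) (i₀ : Fin n) :
    (n : ℝ) * ∫ x : EuclideanSpace ℝ (Fin n), h x * x i₀ ^ 2 = ∫ x, h x * ‖x‖ ^ 2 := by
  have hsym : ∀ i, ∫ x : EuclideanSpace ℝ (Fin n), h x * x i ^ 2 =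
      ∫ x : EuclideanSpace ℝ (Fin n), h x * x i₀ ^ 2 := by
    intro i
    let σ := LinearIsometryEquiv.piLpCongrLeft 2 ℝ ℝ (Equiv.swap i i₀)
    rw [← σ.measurePreserving.integral_comp σ.toHomeomorph.measurableEmbedding]
    refine integral_congr_ae (Eventually.of_forall fun x => ?_)
    have h1 : h (σ x) = h x := hrad _ _ (σ.norm_map x)
    have h2 : (σ x) i = x i₀ := by
      simp [σ, LinearIsometryEquiv.piLpCongrLeft_apply]
    simp only [h1, h2]
  calc (n : ℝ) * ∫ x : EuclideanSpace ℝ (Fin n), h x * x i₀ ^ 2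
      = ∑ i : Fin n, ∫ x : EuclideanSpace ℝ (Fin n), h x * x i ^ 2 := by simp [hsym]
    _ = ∫ x : EuclideanSpace ℝ (Fin n), ∑ i : Fin n, h x * x i ^ 2 :=
        (integral_finsetSum _ fun i _ => hi i).symm
    _ = _ := by simp only [← Finset.mul_sum, sum_sq_eq_norm_sq]

theorem hasCompactSupport_of_norm_sq {F : Type*} [Zero F] {g : EuclideanSpace ℝ (Fin n) → F}
    {R : ℝ} (h : ∀ x, R ≤ ‖x‖ ^ 2 → g x = 0) : HasCompactSupport g := by
  refine HasCompactSupport.intro (isCompact_closedBall (0 : EuclideanSpace ℝ (Fin n)) √R)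
    fun x hx => h x ?_
  rw [mem_closedBall_zero_iff, not_le] at hx
  rcases le_total 0 R with hR | hR
  · rw [← Real.sq_sqrt hR]
    exact pow_le_pow_left₀ (Real.sqrt_nonneg R) hx.le 2
  · exact hR.trans (sq_nonneg _)

/-! ### Displaced radial trial functions -/

/-- The convex function `s ↦ s^(-3/2)` of `s = r²` lies above its tangent at `s = c²`. A bound
polynomial in `r²` reduces the dipole energy to moments of the density. -/
theorem one_div_pow_three_ge {r c : ℝ} (hr : 0 < r) (hc : 0 < c) :
    1 / c ^ 3 * (5 / 2 - 3 / (2 * c ^ 2) * r ^ 2) ≤ 1 / r ^ 3 := by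
  have key : 0 ≤ (r - c) ^ 2 * (3 * r ^ 3 + 6 * r ^ 2 * c + 4 * r * c ^ 2 + 2 * c ^ 3) := by
    positivity
  have e : 1 / r ^ 3 - 1 / c ^ 3 * (5 / 2 - 3 / (2 * c ^ 2) * r ^ 2) =
      (r - c) ^ 2 * (3 * r ^ 3 + 6 * r ^ 2 * c + 4 * r * c ^ 2 + 2 * c ^ 3) /
        (2 * r ^ 3 * c ^ 5) := by
    field_simp
    ring
  have : 0 ≤ 1 / r ^ 3 - 1 / c ^ 3 * (5 / 2 - 3 / (2 * c ^ 2) * r ^ 2) := by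
    rw [e]
    positivity
  linarith

/-- A lower bound for the dipole energy of a displaced radially decreasing density `ρ`. -/
theorem integral_dipole_displaced_ge {ρ : EuclideanSpace ℝ (Fin n) → ℝ} (hρc : Continuous ρ)
    (hρs : HasCompactSupport ρ) (hρ : ∀ x y, ‖x‖ ≤ ‖y‖ → ρ y ≤ ρ x) (hn : 0 < n) (i₀ : Fin n)
    {v c : ℝ} (hv : 0 < v) (hc : 0 < c)
    (hi : Integrable fun x : EuclideanSpace ℝ (Fin n) =>
      x i₀ / ‖x‖ ^ 3 * ρ (x - EuclideanSpace.single i₀ v)) :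
    v / c ^ 3 * (5 / 2 * (∫ x, ρ x) - 3 / (2 * c ^ 2) *
      ((1 + 2 / n) * (∫ x, ρ x * ‖x‖ ^ 2) + v ^ 2 * ∫ x, ρ x)) ≤
    ∫ x : EuclideanSpace ℝ (Fin n), x i₀ / ‖x‖ ^ 3 * ρ (x - EuclideanSpace.single i₀ v) := by
  set e : EuclideanSpace ℝ (Fin n) := EuclideanSpace.single i₀ v with he
  have hrad : ∀ x y, ‖x‖ = ‖y‖ → ρ x = ρ y := fun x y h =>
    le_antisymm (hρ _ _ h.ge) (hρ _ _ h.le)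
  have heven : ∀ x, ρ (-x) = ρ x := fun x => hrad _ _ (norm_neg x)
  have hcoord : Continuous fun x : EuclideanSpace ℝ (Fin n) => x i₀ := by fun_prop
  have h_int : ∀ p : EuclideanSpace ℝ (Fin n) → ℝ, Continuous p →
      Integrable fun x => p x * ρ x := fun p hp =>
    (hp.mul hρc).integrable_of_hasCompactSupport hρs.mul_left
  have h_intT : ∀ p : EuclideanSpace ℝ (Fin n) → ℝ, Continuous p →
      Integrable fun x => p x * ρ (x - e) := by
    intro p hp
    have := (h_int (fun x => p (x + e)) (by fun_prop)).comp_sub_right e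
    simpa using this
  set P : EuclideanSpace ℝ (Fin n) → ℝ :=
    fun x => 1 / c ^ 3 * (5 / 2 - 3 / (2 * c ^ 2) * ‖x‖ ^ 2) with hP
  have hPc : Continuous P := by fun_prop
  -- reflection `x ↦ -x` antisymmetrizes the density
  have hanti : ∀ p : EuclideanSpace ℝ (Fin n) → ℝ, (∀ x, p (-x) = -p x) →
      (Integrable fun x => p x * ρ (x - e)) →
      (Integrable fun x => p x * (ρ (x - e) - ρ (x + e))) ∧
      ∫ x, p x * (ρ (x - e) - ρ (x + e)) = 2 * ∫ x, p x * ρ (x - e) := by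
    intro p hp hpi
    have hneg : (fun x => p x * ρ (x + e)) = fun x => -(p (-x) * ρ (-x - e)) := by
      funext x
      rw [hp, ← heven (x + e), neg_add']
      ring
    have hpi' : Integrable fun x => p x * ρ (x + e) := by
      rw [hneg]
      exact hpi.comp_neg.neg
    have h2 : ∫ x, p x * ρ (x + e) = -∫ x, p x * ρ (x - e) := by
      rw [hneg, integral_neg, integral_neg_eq_self (fun x => p x * ρ (x - e)) volume]
    simp only [mul_sub]
    refine ⟨hpi.sub hpi', ?_⟩
    rw [integral_sub hpi hpi', h2]
    ring
  obtain ⟨hV1, hV2⟩ := hanti (fun x => x i₀ / ‖x‖ ^ 3)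
    (fun x => by simp [neg_div]) hi
  obtain ⟨hQ1, hQ2⟩ := hanti (fun x => x i₀ * P x) (fun x => by simp [hP])
    (h_intT _ (hcoord.mul hPc))
  have hsub : ∀ x : EuclideanSpace ℝ (Fin n), ‖x + e‖ ^ 2 - ‖x - e‖ ^ 2 = 4 * v * x i₀ := by
    intro x
    rw [norm_add_sq_real, norm_sub_sq_real, he, EuclideanSpace.inner_single_right]
    simp
    ring
  -- The tangent bound cannot be multiplied by `x i₀`, whose sign changes. After antisymmetrization
  -- it is multiplied by `x i₀ * (ρ (x - e) - ρ (x + e))`, which is nonnegative because `x` is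
  -- nearer to `e` than to `-e` exactly when `x i₀ > 0` and `ρ` decreases radially.
  have hmono : ∫ x : EuclideanSpace ℝ (Fin n), x i₀ * P x * (ρ (x - e) - ρ (x + e)) ≤
      ∫ x : EuclideanSpace ℝ (Fin n), x i₀ / ‖x‖ ^ 3 * (ρ (x - e) - ρ (x + e)) := by
    refine integral_mono hQ1 hV1 fun x => ?_
    have hd : 0 ≤ x i₀ * (ρ (x - e) - ρ (x + e)) := by
      have hx := hsub x
      rcases le_total 0 (x i₀) with h0 | h0
      · refine mul_nonneg h0 (sub_nonneg.2 (hρ _ _ ?_))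
        refine le_of_sq_le_sq ?_ (norm_nonneg _)
        nlinarith
      · refine mul_nonneg_of_nonpos_of_nonpos h0 (sub_nonpos.2 (hρ _ _ ?_))
        refine le_of_sq_le_sq ?_ (norm_nonneg _)
        nlinarith
    rcases (norm_nonneg x).eq_or_lt with h0 | h0
    · have : x = 0 := norm_eq_zero.1 h0.symm
      simp [this]
    · have := mul_le_mul_of_nonneg_left (one_div_pow_three_ge h0 hc) hd
      calc x i₀ * P x * (ρ (x - e) - ρ (x + e)) = x i₀ * (ρ (x - e) - ρ (x + e)) * P x := by ring
        _ ≤ x i₀ * (ρ (x - e) - ρ (x + e)) * (1 / ‖x‖ ^ 3) := this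
        _ = _ := by ring
  rw [hV2, hQ2] at hmono
  refine le_trans (le_of_eq ?_) (le_of_mul_le_mul_left hmono two_pos)
  have hshift : ∫ x : EuclideanSpace ℝ (Fin n), x i₀ * P x * ρ (x - e) =
      ∫ x : EuclideanSpace ℝ (Fin n), (x i₀ + v) * P (x + e) * ρ x := by
    rw [← integral_add_right_eq_self _ e]
    simp [he]
  rw [hshift]
  -- Sorted by parity in `x`: the last term is odd and integrates to zero, and the `x i₀ ^ 2` term
  -- produces the `2 / n` in the statement.
  have hexp : ∀ x : EuclideanSpace ℝ (Fin n), (x i₀ + v) * P (x + e) * ρ x =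
      (v / c ^ 3 * (5 / 2 - 3 / (2 * c ^ 2) * v ^ 2)) * ρ x
      - (v / c ^ 3 * (3 / (2 * c ^ 2))) * (ρ x * ‖x‖ ^ 2)
      - (2 * (v / c ^ 3 * (3 / (2 * c ^ 2)))) * (ρ x * x i₀ ^ 2)
      + x i₀ * (1 / c ^ 3 * (5 / 2 - 3 / (2 * c ^ 2) * (‖x‖ ^ 2 + 3 * v ^ 2))) * ρ x := by
    intro x
    have : ‖x + e‖ ^ 2 = ‖x‖ ^ 2 + 2 * v * x i₀ + v ^ 2 := by
      rw [norm_add_sq_real, he, EuclideanSpace.inner_single_right]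
      simp
      ring
    simp only [hP, this]
    ring
  have i1 : Integrable ρ := hρc.integrable_of_hasCompactSupport hρs
  have i2 : Integrable fun x => ρ x * ‖x‖ ^ 2 := by
    simpa only [mul_comm] using h_int (fun x => ‖x‖ ^ 2) (by fun_prop)
  have i3 : ∀ i, Integrable fun x : EuclideanSpace ℝ (Fin n) => ρ x * x i ^ 2 := fun i => by
    simpa only [mul_comm] using h_int (fun x => x i ^ 2) (by fun_prop)
  have hodd := integral_eq_zero_of_odd (n := n) (g := fun x => x i₀ * (1 / c ^ 3 *
    (5 / 2 - 3 / (2 * c ^ 2) * (‖x‖ ^ 2 + 3 * v ^ 2))) * ρ x) (fun x => by simp [heven])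
  have i4 := h_int (fun x => x i₀ * (1 / c ^ 3 *
    (5 / 2 - 3 / (2 * c ^ 2) * (‖x‖ ^ 2 + 3 * v ^ 2)))) (by fun_prop)
  have hsq := integral_mul_coord_sq hrad i3 i₀
  have j1 := i1.const_mul (v / c ^ 3 * (5 / 2 - 3 / (2 * c ^ 2) * v ^ 2))
  have j2 := i2.const_mul (v / c ^ 3 * (3 / (2 * c ^ 2)))
  have j3 := (i3 i₀).const_mul (2 * (v / c ^ 3 * (3 / (2 * c ^ 2))))
  simp only [hexp]
  rw [integral_add (by exact (j1.sub j2).sub j3) i4, hodd,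
    integral_sub (by exact j1.sub j2) j3,
    integral_sub j1 j2, integral_const_mul, integral_const_mul,
    integral_const_mul, ← hsq]
  have hn' : (n : ℝ) ≠ 0 := by exact_mod_cast hn.ne'
  field_simp
  ring

theorem hasFDerivAt_comp_norm_sq {Φ : ℝ → ℝ} {Φ' : ℝ} {x : EuclideanSpace ℝ (Fin n)}
    (h : HasDerivAt Φ Φ' (‖x‖ ^ 2)) :
    HasFDerivAt (fun y => Φ (‖y‖ ^ 2)) ((2 * Φ') • innerSL ℝ x) x := by
  convert! h.comp_hasFDerivAt x (hasStrictFDerivAt_norm_sq x).hasFDerivAt using 1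
  ext v
  simp
  ring

/-- The constraint on the coupling constant given by a displaced radial trial function. -/
theorem DipoleHardy.displaced_trial {γ : ℝ} (h : DipoleHardy n γ) (hγ : 0 ≤ γ) (hn : 0 < n)
    {Φ : ℝ → ℝ} (hΦ : ContDiff ℝ ∞ Φ) (hanti : Antitone Φ) (h0 : ∀ w, 0 ≤ Φ w) {R : ℝ}
    (hR : ∀ w, R ≤ w → Φ w = 0) {v c : ℝ} (hv : 0 < v) (hc : 0 < c) :
    γ * (v / c ^ 3 * (5 / 2 * (∫ x : EuclideanSpace ℝ (Fin n), Φ (‖x‖ ^ 2) ^ 2)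
      - 3 / (2 * c ^ 2) *
      ((1 + 2 / n) * (∫ x : EuclideanSpace ℝ (Fin n), Φ (‖x‖ ^ 2) ^ 2 * ‖x‖ ^ 2)
        + v ^ 2 * ∫ x : EuclideanSpace ℝ (Fin n), Φ (‖x‖ ^ 2) ^ 2))) ≤
    ∫ x : EuclideanSpace ℝ (Fin n), 4 * deriv Φ (‖x‖ ^ 2) ^ 2 * ‖x‖ ^ 2 := by
  let i₀ : Fin n := ⟨0, hn⟩
  set e : EuclideanSpace ℝ (Fin n) := EuclideanSpace.single i₀ v
  have hφ : ContDiff ℝ ∞ fun x : EuclideanSpace ℝ (Fin n) => Φ (‖x‖ ^ 2) :=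
    hΦ.comp (contDiff_id.norm_sq ℝ)
  have hφs : HasCompactSupport fun x : EuclideanSpace ℝ (Fin n) => Φ (‖x‖ ^ 2) :=
    hasCompactSupport_of_norm_sq fun x hx => hR _ hx
  have hg : ContDiff ℝ ∞ fun x : EuclideanSpace ℝ (Fin n) => Φ (‖x - e‖ ^ 2) :=
    hφ.comp (contDiff_id.sub contDiff_const)
  have hgs : HasCompactSupport fun x : EuclideanSpace ℝ (Fin n) => Φ (‖x - e‖ ^ 2) :=
    hφs.comp_homeomorph (Homeomorph.subRight e)
  obtain ⟨hi, hle⟩ := h.real_test i₀ hg hgs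
  have hgrad : ∀ x : EuclideanSpace ℝ (Fin n),
      ∑ i, fderiv ℝ (fun x : EuclideanSpace ℝ (Fin n) => Φ (‖x - e‖ ^ 2)) x
        (EuclideanSpace.single i (1 : ℝ)) ^ 2 =
      4 * deriv Φ (‖x - e‖ ^ 2) ^ 2 * ‖x - e‖ ^ 2 := by
    intro x
    have h1 := hasFDerivAt_comp_norm_sq (x := x - e)
      ((hΦ.differentiable (by simp) (‖x - e‖ ^ 2)).hasDerivAt)
    have h2 : HasFDerivAt (fun x : EuclideanSpace ℝ (Fin n) => Φ (‖x - e‖ ^ 2)) _ x :=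
      HasFDerivAt.comp (g := fun y => Φ (‖y‖ ^ 2)) x h1 ((hasFDerivAt_id x).sub_const e)
    rw [h2.fderiv]
    rw [← sum_sq_eq_norm_sq, Finset.mul_sum]
    refine Finset.sum_congr rfl fun i _ => ?_
    simp [EuclideanSpace.inner_single_right]
    ring
  have hρ := integral_dipole_displaced_ge (ρ := fun x => Φ (‖x‖ ^ 2) ^ 2)
    (hφ.continuous.pow 2)
    (hφs.comp_left (g := fun t : ℝ => t ^ 2) (by simp))
    (fun x y hxy => pow_le_pow_left₀ (h0 _)
      (hanti (pow_le_pow_left₀ (norm_nonneg _) hxy 2)) 2) hn i₀ hv hc hi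
  refine (mul_le_mul_of_nonneg_left hρ hγ).trans (hle.trans_eq ?_)
  simp only [hgrad]
  exact integral_sub_right_eq_self
    (fun x : EuclideanSpace ℝ (Fin n) => 4 * deriv Φ (‖x‖ ^ 2) ^ 2 * ‖x‖ ^ 2) e

/-! ### The displaced Gaussian -/

theorem integrable_exp_neg_mul_norm_sq {b : ℝ} (hb : 0 < b) :
    Integrable fun x : EuclideanSpace ℝ (Fin n) => Real.exp (-b * ‖x‖ ^ 2) := by
  refine Integrable.of_integral_ne_zero ?_
  rw [GaussianFourier.integral_rexp_neg_mul_sq_norm hb]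
  positivity

theorem integrable_gaussian : Integrable fun x : EuclideanSpace ℝ (Fin n) =>
    Real.exp (-‖x‖ ^ 2) := by
  simpa using integrable_exp_neg_mul_norm_sq (n := n) one_pos

theorem integrable_gaussian_mul_norm_sq : Integrable fun x : EuclideanSpace ℝ (Fin n) =>
    Real.exp (-‖x‖ ^ 2) * ‖x‖ ^ 2 := by
  refine ((integrable_exp_neg_mul_norm_sq (n := n) (half_pos one_pos)).const_mul 2).mono'
    (by fun_prop) (Eventually.of_forall fun x => ?_)
  rw [Real.norm_eq_abs, abs_of_nonneg (by positivity)]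
  have h1 : ‖x‖ ^ 2 / 2 ≤ Real.exp (‖x‖ ^ 2 / 2) := by
    linarith [Real.add_one_le_exp (‖x‖ ^ 2 / 2)]
  have h2 : Real.exp (-‖x‖ ^ 2) * Real.exp (‖x‖ ^ 2 / 2) = Real.exp (-(1 / 2) * ‖x‖ ^ 2) := by
    rw [← Real.exp_add]
    congr 1
    ring
  rw [← h2]
  nlinarith [Real.exp_pos (-‖x‖ ^ 2)]

/-- In polar coordinates the two integrals are a common factor times `Γ(n/2 + 1)` and `Γ(n/2)`. -/
theorem integral_gaussian_mul_norm_sq (hn : 0 < n) :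
    ∫ x : EuclideanSpace ℝ (Fin n), Real.exp (-‖x‖ ^ 2) * ‖x‖ ^ 2 =
      n / 2 * ∫ x : EuclideanSpace ℝ (Fin n), Real.exp (-‖x‖ ^ 2) := by
  have : Nonempty (Fin n) := ⟨⟨0, hn⟩⟩
  have hn' : (0 : ℝ) < n := by exact_mod_cast hn
  have h1 := integral_fun_norm_addHaar (volume : Measure (EuclideanSpace ℝ (Fin n)))
    fun r => Real.exp (-r ^ 2) * r ^ 2
  have h2 := integral_fun_norm_addHaar (volume : Measure (EuclideanSpace ℝ (Fin n)))
    fun r => Real.exp (-r ^ 2)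
  have e1 : ∫ y in Set.Ioi (0 : ℝ), y ^ (n - 1) • (Real.exp (-y ^ 2) * y ^ 2) =
      1 / 2 * Real.Gamma ((n + 1 + 1) / 2) := by
    rw [← integral_rpow_mul_exp_neg_rpow (p := 2) (q := n + 1) two_pos (by linarith)]
    refine setIntegral_congr_fun measurableSet_Ioi fun y hy => ?_
    have : y ^ ((n : ℝ) + 1) = y ^ (n - 1) * y ^ 2 := by
      rw [← pow_add, ← Real.rpow_natCast]
      congr 1
      rw [show n - 1 + 2 = n + 1 by omega]
      push_cast
      rfl
    simp only [smul_eq_mul, this, Real.rpow_two]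
    ring
  have e2 : ∫ y in Set.Ioi (0 : ℝ), y ^ (n - 1) • Real.exp (-y ^ 2) =
      1 / 2 * Real.Gamma ((n - 1 + 1) / 2) := by
    rw [← integral_rpow_mul_exp_neg_rpow (p := 2) (q := n - 1) two_pos (by linarith)]
    refine setIntegral_congr_fun measurableSet_Ioi fun y hy => ?_
    have : y ^ ((n : ℝ) - 1) = y ^ (n - 1) := by
      rw [← Real.rpow_natCast, Nat.cast_sub hn, Nat.cast_one]
    simp only [smul_eq_mul, this, Real.rpow_two]
  have hΓ : Real.Gamma (((n : ℝ) + 1 + 1) / 2) = n / 2 * Real.Gamma (((n : ℝ) - 1 + 1) / 2) := by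
    rw [show ((n : ℝ) + 1 + 1) / 2 = n / 2 + 1 by ring, Real.Gamma_add_one (by positivity)]
    simp
  simp only [finrank_euclideanSpace_fin] at h1 h2
  rw [h1, h2, e1, e2, hΓ]
  simp only [nsmul_eq_mul, smul_eq_mul]
  ring

theorem exists_abs_deriv_smoothTransition_le :
    ∃ C : ℝ, 0 ≤ C ∧ ∀ x, |deriv Real.smoothTransition x| ≤ C := by
  have hc : Continuous (deriv Real.smoothTransition) :=
    (Real.smoothTransition.contDiff (n := 1)).continuous_deriv le_rfl
  have hs : HasCompactSupport (deriv Real.smoothTransition) := by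
    refine HasCompactSupport.intro (isCompact_Icc (a := 0) (b := 1)) fun x hx => ?_
    rw [Set.mem_Icc, not_and_or, not_le, not_le] at hx
    rcases hx with hx | hx
    · have : Real.smoothTransition =ᶠ[𝓝 x] fun _ => 0 := by
        filter_upwards [Iio_mem_nhds hx] with y hy
        exact Real.smoothTransition.zero_of_nonpos hy.le
      rw [this.deriv_eq, deriv_const]
    · have : Real.smoothTransition =ᶠ[𝓝 x] fun _ => 1 := by
        filter_upwards [Ioi_mem_nhds hx] with y hy
        exact Real.smoothTransition.one_of_one_le hy.le
      rw [this.deriv_eq, deriv_const]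
  obtain ⟨C, hC⟩ := hs.exists_bound_of_continuous hc
  exact ⟨C, (norm_nonneg _).trans (hC 0), hC⟩

/-- The function `w ↦ exp (-w / 2)`, smoothly cut off between `k` and `2 k`. -/
def cutGaussian (k w : ℝ) : ℝ := Real.smoothTransition (2 - w / k) * Real.exp (-w / 2)

theorem contDiff_cutGaussian (k : ℝ) : ContDiff ℝ ∞ (cutGaussian k) := by
  unfold cutGaussian
  have h : ContDiff ℝ ∞ fun w : ℝ => 2 - w / k := by fun_prop
  exact (Real.smoothTransition.contDiff.comp h).mul (by fun_prop)

theorem cutGaussian_nonneg (k w : ℝ) : 0 ≤ cutGaussian k w :=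
  mul_nonneg (Real.smoothTransition.nonneg _) (Real.exp_pos _).le

theorem antitone_cutGaussian {k : ℝ} (hk : 0 < k) : Antitone (cutGaussian k) := by
  intro w w' h
  unfold cutGaussian
  have h1 : w / k ≤ w' / k := by gcongr
  refine mul_le_mul (Real.smoothTransition.monotone (by linarith))
    (Real.exp_le_exp.2 (by linarith)) (Real.exp_pos _).le (Real.smoothTransition.nonneg _)

theorem cutGaussian_eq_zero {k w : ℝ} (hk : 0 < k) (hw : 2 * k ≤ w) : cutGaussian k w = 0 := by
  have : 2 ≤ w / k := by rwa [le_div_iff₀ hk]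
  rw [cutGaussian, Real.smoothTransition.zero_of_nonpos (by linarith), zero_mul]

theorem deriv_cutGaussian (k w : ℝ) : deriv (cutGaussian k) w =
    (-(deriv Real.smoothTransition (2 - w / k) / k) - Real.smoothTransition (2 - w / k) / 2)
      * Real.exp (-w / 2) := by
  have h1 : HasDerivAt (fun w : ℝ => 2 - w / k) (-(1 / k)) w :=
    ((hasDerivAt_id w).div_const k).const_sub 2
  have h2 : HasDerivAt (fun w : ℝ => Real.exp (-w / 2)) (Real.exp (-w / 2) * (-1 / 2)) w :=
    ((hasDerivAt_id w).neg.div_const 2).exp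
  have h3 : HasDerivAt Real.smoothTransition _ (2 - w / k) :=
    ((Real.smoothTransition.contDiff (n := 1)).differentiable one_ne_zero _).hasDerivAt
  have h4 := (h3.comp w h1).mul h2
  refine h4.deriv.trans ?_
  simp only [Function.comp_apply]
  ring

theorem exp_neg_half_sq (w : ℝ) : Real.exp (-w / 2) ^ 2 = Real.exp (-w) := by
  rw [← Real.exp_nat_mul]
  congr 1
  push_cast
  ring

theorem cutGaussian_sq_le (k w : ℝ) : cutGaussian k w ^ 2 ≤ Real.exp (-w) := by
  rw [cutGaussian, mul_pow, exp_neg_half_sq]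
  exact mul_le_of_le_one_left (Real.exp_pos _).le
    (pow_le_one₀ (Real.smoothTransition.nonneg _) (Real.smoothTransition.le_one _))

theorem eventually_smoothTransition_eq_one (w : ℝ) :
    ∀ᶠ k : ℝ in atTop, Real.smoothTransition (2 - w / k) = 1 := by
  filter_upwards [eventually_ge_atTop w, eventually_gt_atTop 0] with k hk hk0
  refine Real.smoothTransition.one_of_one_le ?_
  have : w / k ≤ 1 := by rwa [div_le_one hk0]
  linarith

theorem tendsto_cutGaussian_sq (w : ℝ) :
    Tendsto (fun k => cutGaussian k w ^ 2) atTop (𝓝 (Real.exp (-w))) := by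
  refine tendsto_const_nhds.congr' ?_
  filter_upwards [eventually_smoothTransition_eq_one w] with k hk
  rw [cutGaussian, hk, one_mul, exp_neg_half_sq]

theorem tendsto_deriv_cutGaussian_sq (w : ℝ) :
    Tendsto (fun k => 4 * deriv (cutGaussian k) w ^ 2) atTop (𝓝 (Real.exp (-w))) := by
  obtain ⟨C, hC0, hC⟩ := exists_abs_deriv_smoothTransition_le
  have h1 : Tendsto (fun k : ℝ => deriv Real.smoothTransition (2 - w / k) / k) atTop (𝓝 0) := by
    refine squeeze_zero_norm' ?_ (tendsto_const_nhds.div_atTop tendsto_id : Tendsto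
      (fun k : ℝ => C / id k) atTop (𝓝 0))
    filter_upwards [eventually_gt_atTop 0] with k hk
    rw [norm_div, Real.norm_eq_abs, Real.norm_eq_abs, abs_of_pos hk]
    exact div_le_div_of_nonneg_right (hC _) hk.le
  have h2 : Tendsto (fun k : ℝ => Real.smoothTransition (2 - w / k) / 2) atTop (𝓝 (1 / 2)) := by
    refine tendsto_const_nhds.congr' ?_
    filter_upwards [eventually_smoothTransition_eq_one w] with k hk
    rw [hk]
  simp only [deriv_cutGaussian]
  have h3 := ((((h1.neg.sub h2).mul_const (Real.exp (-w / 2))).pow 2).const_mul 4)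
  convert! h3 using 2
  rw [mul_pow, exp_neg_half_sq]
  ring

/-- The constraint on the coupling constant given by the displaced Gaussian. -/
theorem DipoleHardy.gaussian_trial {γ : ℝ} (h : DipoleHardy n γ) (hγ : 0 ≤ γ) (hn : 0 < n)
    {v c : ℝ} (hv : 0 < v) (hc : 0 < c) :
    γ * (v / c ^ 3 * (5 / 2 - 3 / (2 * c ^ 2) * ((n + 2) / 2 + v ^ 2))) ≤ n / 2 := by
  obtain ⟨C, hC0, hC⟩ := exists_abs_deriv_smoothTransition_le
  have hN : Tendsto (fun k => ∫ x : EuclideanSpace ℝ (Fin n), cutGaussian k (‖x‖ ^ 2) ^ 2) atTop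
      (𝓝 (∫ x : EuclideanSpace ℝ (Fin n), Real.exp (-‖x‖ ^ 2))) := by
    refine tendsto_integral_filter_of_dominated_convergence _
      (Eventually.of_forall fun k => ?_) (Eventually.of_forall fun k => ?_)
      integrable_gaussian (Eventually.of_forall fun x => tendsto_cutGaussian_sq _)
    · have := (contDiff_cutGaussian k).continuous
      exact Continuous.aestronglyMeasurable (by fun_prop)
    · refine Eventually.of_forall fun x => ?_
      rw [Real.norm_eq_abs, abs_of_nonneg (by positivity)]
      exact cutGaussian_sq_le _ _
  have hM : Tendsto (fun k => ∫ x : EuclideanSpace ℝ (Fin n),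
      cutGaussian k (‖x‖ ^ 2) ^ 2 * ‖x‖ ^ 2) atTop
      (𝓝 (∫ x : EuclideanSpace ℝ (Fin n), Real.exp (-‖x‖ ^ 2) * ‖x‖ ^ 2)) := by
    refine tendsto_integral_filter_of_dominated_convergence _
      (Eventually.of_forall fun k => ?_) (Eventually.of_forall fun k => ?_)
      integrable_gaussian_mul_norm_sq
      (Eventually.of_forall fun x => (tendsto_cutGaussian_sq _).mul_const _)
    · have := (contDiff_cutGaussian k).continuous
      exact Continuous.aestronglyMeasurable (by fun_prop)
    · refine Eventually.of_forall fun x => ?_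
      rw [Real.norm_eq_abs, abs_of_nonneg (by positivity)]
      gcongr
      exact cutGaussian_sq_le _ _
  have hK : Tendsto (fun k => ∫ x : EuclideanSpace ℝ (Fin n),
      4 * deriv (cutGaussian k) (‖x‖ ^ 2) ^ 2 * ‖x‖ ^ 2) atTop
      (𝓝 (∫ x : EuclideanSpace ℝ (Fin n), Real.exp (-‖x‖ ^ 2) * ‖x‖ ^ 2)) := by
    refine tendsto_integral_filter_of_dominated_convergence
      -- For `k ≥ 1` the derivative of the cutoff contributes at most `C / k ≤ C`, and that of `exp
      -- (-w / 2)` at most `1 / 2`.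
      (fun x => 4 * (C + 1 / 2) ^ 2 * (Real.exp (-‖x‖ ^ 2) * ‖x‖ ^ 2))
      (Eventually.of_forall fun k => ?_) ?_
      (integrable_gaussian_mul_norm_sq.const_mul _)
      (Eventually.of_forall fun x => (tendsto_deriv_cutGaussian_sq _).mul_const _)
    · have := (contDiff_cutGaussian k).continuous_deriv (by simp)
      exact Continuous.aestronglyMeasurable (by fun_prop)
    · filter_upwards [eventually_ge_atTop 1] with k hk
      refine Eventually.of_forall fun x => ?_
      rw [Real.norm_eq_abs, abs_of_nonneg (by positivity), deriv_cutGaussian, mul_pow,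
        exp_neg_half_sq, ← mul_assoc, ← mul_assoc]
      gcongr 4 * ?_ * _ * _
      refine sq_le_sq' ?_ ?_ <;>
      · have h1 : |deriv Real.smoothTransition (2 - ‖x‖ ^ 2 / k) / k| ≤ C := by
          rw [abs_div, abs_of_pos (by linarith : 0 < k)]
          exact (div_le_self (abs_nonneg _) hk).trans (hC _)
        have h2 := Real.smoothTransition.nonneg (2 - ‖x‖ ^ 2 / k)
        have h3 := Real.smoothTransition.le_one (2 - ‖x‖ ^ 2 / k)
        have h4 := abs_le.1 h1
        linarith [h4.1, h4.2]
  have hlim := le_of_tendsto_of_tendsto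
    ((((hN.const_mul (5 / 2)).sub (((hM.const_mul (1 + 2 / (n : ℝ))).add
      (hN.const_mul (v ^ 2))).const_mul (3 / (2 * c ^ 2)))).const_mul (v / c ^ 3)).const_mul γ) hK
    (by
      filter_upwards [eventually_gt_atTop 0] with k hk
      exact h.displaced_trial hγ hn (contDiff_cutGaussian k) (antitone_cutGaussian hk)
        (cutGaussian_nonneg k) (fun w hw => cutGaussian_eq_zero hk hw) hv hc)
  rw [integral_gaussian_mul_norm_sq hn] at hlim
  have hZ : 0 < ∫ x : EuclideanSpace ℝ (Fin n), Real.exp (-‖x‖ ^ 2) := by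
    have := GaussianFourier.integral_rexp_neg_mul_sq_norm (V := EuclideanSpace ℝ (Fin n))
      (one_pos : (0 : ℝ) < 1)
    simp only [neg_mul, one_mul] at this
    rw [this]
    positivity
  have hn' : (n : ℝ) ≠ 0 := by exact_mod_cast hn.ne'
  refine le_of_mul_le_mul_right (le_trans (le_of_eq ?_) hlim) hZ
  field_simp

/-- In `gaussian_trial`, the choice `c² = (n + 2) / 2 + v²` makes the bracket equal to `1`, leaving
`v / c³` to be maximized. The maximum is at `v² = (n + 2) / 4`, where `c = √3 v`, that is, `v / c =
1/√3`. -/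
theorem DipoleHardy.le_gaussian_bound {γ : ℝ} (h : DipoleHardy n γ) (hγ : 0 ≤ γ) (hn : 0 < n) :
    γ ≤ 3 * √3 / 8 * (n * (n + 2)) := by
  have hn' : (0 : ℝ) < n := by exact_mod_cast hn
  set v := √((n : ℝ) + 2) / 2 with hv
  have hv0 : 0 < v := by positivity
  have hv2 : v ^ 2 = (n + 2) / 4 := by
    rw [hv, div_pow, Real.sq_sqrt (by positivity)]
    norm_num
  have h3 : √3 ^ 2 = 3 := Real.sq_sqrt (by norm_num)
  have hg := h.gaussian_trial hγ hn hv0 (by positivity : 0 < √3 * v)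
  have e : v / (√3 * v) ^ 3 * (5 / 2 - 3 / (2 * (√3 * v) ^ 2) * ((n + 2) / 2 + v ^ 2)) =
      1 / (3 * √3 * ((n + 2) / 4)) := by
    rw [mul_pow, mul_pow, h3, show ((n : ℝ) + 2) / 2 = 2 * v ^ 2 by rw [hv2]; ring, ← hv2,
      pow_succ √3, h3]
    field_simp
    ring
  rw [e, mul_one_div, div_le_iff₀ (by positivity)] at hg
  linarith

/-! ### Trial functions in logarithmic polar coordinates -/

/-- Profiles vanishing below `1` thus vanish near the origin, including at the origin itself, where
`Real.log 0 = 0`. -/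
theorem eventually_log_norm_lt_one : ∀ᶠ y in 𝓝 (0 : EuclideanSpace ℝ (Fin n)),
    Real.log ‖y‖ < 1 := by
  filter_upwards [Metric.ball_mem_nhds 0 one_pos] with y hy
  rw [mem_ball_zero_iff] at hy
  exact (Real.log_nonpos (norm_nonneg y) hy.le).trans_lt one_pos

theorem hasCompactSupport_log_norm {ξ : ℝ → ℝ} {L : ℝ} (hL : ∀ τ, L ≤ τ → ξ τ = 0)
    (k : EuclideanSpace ℝ (Fin n) → ℝ) :
    HasCompactSupport fun x => ξ (Real.log ‖x‖) * k x := by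
  refine hasCompactSupport_of_norm_sq (R := Real.exp L ^ 2) fun x hx => ?_
  have h1 : Real.exp L ≤ ‖x‖ := le_of_sq_le_sq hx (norm_nonneg x)
  rw [hL _ ((Real.le_log_iff_exp_le ((Real.exp_pos L).trans_le h1)).2 h1), zero_mul]

theorem contDiff_log_norm_mul {ξ : ℝ → ℝ} (hξ : ContDiff ℝ ∞ ξ) (h1 : ∀ τ, τ < 1 → ξ τ = 0)
    {k : EuclideanSpace ℝ (Fin n) → ℝ} (hk : ∀ x, x ≠ 0 → ContDiffAt ℝ ∞ k x) :
    ContDiff ℝ ∞ fun x => ξ (Real.log ‖x‖) * k x := by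
  rw [contDiff_iff_contDiffAt]
  intro x
  rcases eq_or_ne x 0 with rfl | hx
  · refine (contDiffAt_const (c := (0 : ℝ))).congr_of_eventuallyEq ?_
    filter_upwards [eventually_log_norm_lt_one] with y hy
    rw [h1 _ hy, zero_mul]
  · exact (hξ.contDiffAt.comp x ((contDiffAt_norm ℝ hx).log (norm_ne_zero_iff.2 hx))).mul (hk x hx)

theorem integrable_log_norm_mul {ξ : ℝ → ℝ} (hξ : Continuous ξ) (h1 : ∀ τ, τ < 1 → ξ τ = 0)
    {L : ℝ} (hL : ∀ τ, L ≤ τ → ξ τ = 0)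
    {k : EuclideanSpace ℝ (Fin n) → ℝ} (hk : ∀ x, x ≠ 0 → ContinuousAt k x) :
    Integrable fun x => ξ (Real.log ‖x‖) * k x := by
  refine Continuous.integrable_of_hasCompactSupport ?_ (hasCompactSupport_log_norm hL k)
  rw [continuous_iff_continuousAt]
  intro x
  rcases eq_or_ne x 0 with rfl | hx
  · refine (continuousAt_const (y := (0 : ℝ))).congr ?_
    filter_upwards [eventually_log_norm_lt_one] with y hy
    rw [h1 _ hy, zero_mul]
  · exact (hξ.continuousAt.comp
      ((Real.continuousAt_log (norm_ne_zero_iff.2 hx)).comp continuous_norm.continuousAt)).mul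
      (hk x hx)

/-- Logarithmic polar coordinates. -/
theorem integral_log_norm_div_norm_sq (hn : 2 ≤ n) (ξ : ℝ → ℝ) :
    ∫ x : EuclideanSpace ℝ (Fin n), ξ (Real.log ‖x‖) / ‖x‖ ^ 2 =
      n * volume.real (Metric.ball (0 : EuclideanSpace ℝ (Fin n)) 1) *
        ∫ τ, Real.exp ((n - 2) * τ) * ξ τ := by
  have : Nonempty (Fin n) := ⟨⟨0, by omega⟩⟩
  have h := integral_fun_norm_addHaar (volume : Measure (EuclideanSpace ℝ (Fin n)))
    fun r => ξ (Real.log r) / r ^ 2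
  simp only [finrank_euclideanSpace_fin, nsmul_eq_mul, smul_eq_mul, ← mul_assoc] at h
  rw [h]
  congr 1
  have himg : Set.Ioi (0 : ℝ) = Real.exp '' Set.univ := by rw [Set.image_univ, Real.range_exp]
  rw [himg, integral_image_eq_integral_abs_deriv_smul (f' := Real.exp) MeasurableSet.univ
    (fun x _ => (Real.hasDerivAt_exp x).hasDerivWithinAt) Real.exp_injective.injOn,
    setIntegral_univ]
  congr with τ
  rw [Real.log_exp, abs_of_pos (Real.exp_pos τ), smul_eq_mul]
  have e1 : Real.exp τ * Real.exp τ ^ (n - 1) = Real.exp ((n - 2) * τ) * Real.exp τ ^ 2 := by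
    rw [← pow_succ', ← Real.exp_nat_mul, ← Real.exp_nat_mul, ← Real.exp_add,
      show n - 1 + 1 = n by omega]
    congr 1
    push_cast
    ring
  calc Real.exp τ * (Real.exp τ ^ (n - 1) * (ξ τ / Real.exp τ ^ 2))
      = (Real.exp τ * Real.exp τ ^ (n - 1)) * (ξ τ / Real.exp τ ^ 2) := by ring
    _ = _ := by
      rw [e1]
      field_simp

/-- The trial function `η (log |x|) (1 + t x₀ / |x|)`. -/
def logTrial (η : ℝ → ℝ) (t : ℝ) (i₀ : Fin n) (x : EuclideanSpace ℝ (Fin n)) : ℝ :=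
  η (Real.log ‖x‖) * (1 + t * (x i₀ / ‖x‖))

theorem fderiv_logTrial {η : ℝ → ℝ} (hη : ContDiff ℝ ∞ η) (t : ℝ) (i₀ : Fin n)
    {x : EuclideanSpace ℝ (Fin n)} (hx : x ≠ 0) (v : EuclideanSpace ℝ (Fin n)) :
    fderiv ℝ (logTrial η t i₀) x v =
      (deriv η (Real.log ‖x‖) * (1 + t * (x i₀ / ‖x‖)) - η (Real.log ‖x‖) * (t * (x i₀ / ‖x‖)))
        / ‖x‖ ^ 2 * inner ℝ x v + η (Real.log ‖x‖) * t / ‖x‖ * v i₀ := by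
  have hr : ‖x‖ ≠ 0 := norm_ne_zero_iff.2 hx
  have hnorm : HasFDerivAt (fun y : EuclideanSpace ℝ (Fin n) => ‖y‖) (‖x‖⁻¹ • innerSL ℝ x) x := by
    have h1 : HasFDerivAt (fun y : EuclideanSpace ℝ (Fin n) => √(‖y‖ ^ 2)) _ x :=
      (Real.hasDerivAt_sqrt (pow_ne_zero 2 hr)).comp_hasFDerivAt x
        (hasStrictFDerivAt_norm_sq x).hasFDerivAt
    simp only [Real.sqrt_sq (norm_nonneg _)] at h1
    convert! h1 using 1
    ext w
    simp
    field_simp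
  have hlog := (Real.hasDerivAt_log hr).comp_hasFDerivAt x hnorm
  have hη' := (hη.differentiable (by simp) (Real.log ‖x‖)).hasDerivAt.comp_hasFDerivAt x hlog
  have hinv := (hasDerivAt_inv hr).comp_hasFDerivAt x hnorm
  have hcoord : HasFDerivAt (fun y : EuclideanSpace ℝ (Fin n) => y i₀)
      (EuclideanSpace.proj (𝕜 := ℝ) i₀) x := (EuclideanSpace.proj (𝕜 := ℝ) i₀).hasFDerivAt
  have hfin := hη'.mul (((hcoord.mul hinv).const_mul t).const_add 1)
  have heq : logTrial η t i₀ = (η ∘ Real.log ∘ fun y : EuclideanSpace ℝ (Fin n) => ‖y‖) *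
      fun y : EuclideanSpace ℝ (Fin n) => 1 + t * ((fun y : EuclideanSpace ℝ (Fin n) => y i₀) *
        ((fun r : ℝ => r⁻¹) ∘ fun y : EuclideanSpace ℝ (Fin n) => ‖y‖)) y := by
    funext y
    simp [logTrial, div_eq_mul_inv]
  rw [heq]
  refine (congrArg (fun T => T v) hfin.fderiv).trans ?_
  simp
  field_simp
  ring

theorem sum_fderiv_logTrial_sq {η : ℝ → ℝ} (hη : ContDiff ℝ ∞ η) (t : ℝ) (i₀ : Fin n)
    {x : EuclideanSpace ℝ (Fin n)} (hx : x ≠ 0) :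
    ∑ i, fderiv ℝ (logTrial η t i₀) x (EuclideanSpace.single i (1 : ℝ)) ^ 2 =
      (deriv η (Real.log ‖x‖) ^ 2 * (1 + t * (x i₀ / ‖x‖)) ^ 2 +
        η (Real.log ‖x‖) ^ 2 * t ^ 2 * (1 - (x i₀ / ‖x‖) ^ 2)) / ‖x‖ ^ 2 := by
  have hr : ‖x‖ ≠ 0 := norm_ne_zero_iff.2 hx
  have hgen : ∀ A B : ℝ, ∑ i, (A * x i + B * (EuclideanSpace.single i (1 : ℝ)) i₀) ^ 2 =
      A ^ 2 * ‖x‖ ^ 2 + 2 * A * B * x i₀ + B ^ 2 := by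
    intro A B
    have : ∀ i, (A * x i + B * (EuclideanSpace.single i (1 : ℝ)) i₀) ^ 2 =
        A ^ 2 * x i ^ 2 + (if i₀ = i then 2 * A * B * x i + B ^ 2 else 0) := by
      intro i
      by_cases h : i₀ = i <;> simp [h] <;> ring
    simp only [this, Finset.sum_add_distrib, ← Finset.mul_sum, sum_sq_eq_norm_sq,
      Finset.sum_ite_eq, Finset.mem_univ, if_true]
    ring
  simp only [fderiv_logTrial hη t i₀ hx, EuclideanSpace.inner_single_right, one_mul,
    conj_trivial, hgen]
  field_simp
  ring

/-- The function `ξ (log |x|) |x|⁻² (x₀ / |x|)ʲ`. -/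
def angularTerm (ξ : ℝ → ℝ) (i₀ : Fin n) (j : ℕ) (x : EuclideanSpace ℝ (Fin n)) : ℝ :=
  ξ (Real.log ‖x‖) / ‖x‖ ^ 2 * (x i₀ / ‖x‖) ^ j

theorem integrable_angularTerm {ξ : ℝ → ℝ} (hξ : Continuous ξ) (h1 : ∀ τ, τ < 1 → ξ τ = 0)
    {L : ℝ} (hL : ∀ τ, L ≤ τ → ξ τ = 0) (i₀ : Fin n) (j : ℕ) :
    Integrable (angularTerm ξ i₀ j) := by
  have := integrable_log_norm_mul (n := n) hξ h1 hL
    (k := fun x => (‖x‖ ^ 2)⁻¹ * (x i₀ / ‖x‖) ^ j) (fun x hx => by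
      have hr : ‖x‖ ≠ 0 := norm_ne_zero_iff.2 hx
      have hc : ContinuousAt (fun x : EuclideanSpace ℝ (Fin n) => x i₀) x := by fun_prop
      exact ((continuous_norm.continuousAt.pow 2).inv₀ (pow_ne_zero 2 hr)).mul
        ((hc.div continuous_norm.continuousAt hr).pow j))
  refine this.congr (Eventually.of_forall fun x => ?_)
  simp only [angularTerm]
  ring

theorem integral_angularTerm_odd (ξ : ℝ → ℝ) (i₀ : Fin n) {j : ℕ} (hj : Odd j) :
    ∫ x, angularTerm ξ i₀ j x = 0 := by
  refine integral_eq_zero_of_odd fun x => ?_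
  simp [angularTerm, neg_div, hj.neg_pow]

theorem integral_angularTerm_two {ξ : ℝ → ℝ} (hξ : Continuous ξ) (h1 : ∀ τ, τ < 1 → ξ τ = 0)
    {L : ℝ} (hL : ∀ τ, L ≤ τ → ξ τ = 0) (i₀ : Fin n) :
    n * ∫ x, angularTerm ξ i₀ 2 x = ∫ x, angularTerm ξ i₀ 0 x := by
  have h := integral_mul_coord_sq (n := n) (h := fun x => ξ (Real.log ‖x‖) / ‖x‖ ^ 4)
    (fun x y hxy => by simp only [hxy]) (fun i => by
      refine (integrable_angularTerm hξ h1 hL i 2).congr (Eventually.of_forall fun x => ?_)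
      simp only [angularTerm]
      field_simp) i₀
  convert! h using 2
  · congr 1
    funext x
    simp only [angularTerm]
    field_simp
  · simp only [angularTerm]
    field_simp

theorem contDiff_logTrial {η : ℝ → ℝ} (hη : ContDiff ℝ ∞ η) (h1 : ∀ τ, τ < 1 → η τ = 0) (t : ℝ)
    (i₀ : Fin n) : ContDiff ℝ ∞ (logTrial η t i₀) := by
  refine contDiff_log_norm_mul hη h1 fun x hx => ?_
  have hc : ContDiffAt ℝ ∞ (fun x : EuclideanSpace ℝ (Fin n) => x i₀) x :=
    (EuclideanSpace.proj (𝕜 := ℝ) i₀).contDiff.contDiffAt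
  exact contDiffAt_const.add (contDiffAt_const.mul
    (hc.div (contDiffAt_norm ℝ hx) (norm_ne_zero_iff.2 hx)))

/-- The constraint on the coupling constant given by the trial function `logTrial`. -/
theorem DipoleHardy.logTrial {γ : ℝ} (h : DipoleHardy n γ) (i₀ : Fin n)
    {η : ℝ → ℝ} (hη : ContDiff ℝ ∞ η) (h1 : ∀ τ, τ < 1 → η τ = 0)
    {L : ℝ} (hL : ∀ τ, L < τ → η τ = 0) (t : ℝ) :
    γ * (2 * t * ∫ x, angularTerm (fun τ => η τ ^ 2) i₀ 0 x) ≤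
      (n + t ^ 2) * (∫ x, angularTerm (fun τ => deriv η τ ^ 2) i₀ 0 x) +
      t ^ 2 * (n - 1) * ∫ x, angularTerm (fun τ => η τ ^ 2) i₀ 0 x := by
  have hn : 0 < n := i₀.pos
  have hn' : (0 : ℝ) < n := by exact_mod_cast hn
  have : Nonempty (Fin n) := ⟨i₀⟩
  have hd1 : ∀ τ, τ < 1 → deriv η τ = 0 := fun τ hτ => by
    have : η =ᶠ[𝓝 τ] fun _ => 0 := by
      filter_upwards [Iio_mem_nhds hτ] with y hy using h1 y hy
    rw [this.deriv_eq, deriv_const]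
  have hdL : ∀ τ, L + 1 ≤ τ → deriv η τ = 0 := fun τ hτ => by
    have : η =ᶠ[𝓝 τ] fun _ => 0 := by
      filter_upwards [Ioi_mem_nhds (by linarith : L < τ)] with y hy using hL y hy
    rw [this.deriv_eq, deriv_const]
  have hηL : ∀ τ, L + 1 ≤ τ → η τ = 0 := fun τ hτ => hL τ (by linarith)
  have c1 : Continuous fun τ => η τ ^ 2 := hη.continuous.pow 2
  have c2 : Continuous fun τ => deriv η τ ^ 2 := (hη.continuous_deriv (by simp)).pow 2
  have A := integrable_angularTerm (n := n) (L := L + 1) c1 (fun τ hτ => by simp [h1 τ hτ])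
    (fun τ hτ => by simp [hηL τ hτ]) i₀
  have B := integrable_angularTerm (n := n) (L := L + 1) c2 (fun τ hτ => by simp [hd1 τ hτ])
    (fun τ hτ => by simp [hdL τ hτ]) i₀
  have A2 := integral_angularTerm_two (n := n) (L := L + 1) c1 (fun τ hτ => by simp [h1 τ hτ])
    (fun τ hτ => by simp [hηL τ hτ]) i₀
  have B2 := integral_angularTerm_two (n := n) (L := L + 1) c2 (fun τ hτ => by simp [hd1 τ hτ])
    (fun τ hτ => by simp [hdL τ hτ]) i₀
  have A1 := integral_angularTerm_odd (n := n) (fun τ => η τ ^ 2) i₀ (j := 1) (by decide)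
  have A3 := integral_angularTerm_odd (n := n) (fun τ => η τ ^ 2) i₀ (j := 3) (by decide)
  have B1 := integral_angularTerm_odd (n := n) (fun τ => deriv η τ ^ 2) i₀ (j := 1) (by decide)
  obtain ⟨-, hle⟩ := h.real_test i₀ (contDiff_logTrial hη h1 t i₀)
    (hasCompactSupport_log_norm hηL _)
  set a := angularTerm (n := n) (fun τ => η τ ^ 2) i₀
  set b := angularTerm (n := n) (fun τ => deriv η τ ^ 2) i₀
  -- Of `cos θ (1 + t cos θ)²` only the even power of `cos θ` survives integration.
  have hpot : ∫ x : EuclideanSpace ℝ (Fin n), x i₀ / ‖x‖ ^ 3 * Dipole.logTrial η t i₀ x ^ 2 =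
      2 * t * ∫ x, a 2 x := by
    have : ∀ x : EuclideanSpace ℝ (Fin n), x i₀ / ‖x‖ ^ 3 * Dipole.logTrial η t i₀ x ^ 2 =
        a 1 x + 2 * t * a 2 x + t ^ 2 * a 3 x := by
      intro x
      simp only [a, angularTerm, Dipole.logTrial]
      ring
    simp only [this]
    rw [integral_add (by exact (A 1).add ((A 2).const_mul _)) ((A 3).const_mul _),
      integral_add (A 1) ((A 2).const_mul _), integral_const_mul, integral_const_mul, A1, A3]
    ring
  have hkin : ∫ x : EuclideanSpace ℝ (Fin n), ∑ i, fderiv ℝ (Dipole.logTrial η t i₀) x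
        (EuclideanSpace.single i (1 : ℝ)) ^ 2 =
      (∫ x, b 0 x) + t ^ 2 * (∫ x, b 2 x) + t ^ 2 * (∫ x, a 0 x) - t ^ 2 * ∫ x, a 2 x := by
    have : (fun x : EuclideanSpace ℝ (Fin n) => ∑ i, fderiv ℝ (Dipole.logTrial η t i₀) x
        (EuclideanSpace.single i (1 : ℝ)) ^ 2) =ᵐ[volume] fun x =>
        b 0 x + 2 * t * b 1 x + t ^ 2 * b 2 x + t ^ 2 * a 0 x - t ^ 2 * a 2 x := by
      filter_upwards [compl_mem_ae_iff.2 (measure_singleton (0 : EuclideanSpace ℝ (Fin n)))]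
        with x hx
      rw [sum_fderiv_logTrial_sq hη t i₀ hx]
      simp only [a, b, angularTerm]
      ring
    rw [integral_congr_ae this]
    have j1 := (B 1).const_mul (2 * t)
    have j2 := (B 2).const_mul (t ^ 2)
    have j3 := (A 0).const_mul (t ^ 2)
    have j4 := (A 2).const_mul (t ^ 2)
    rw [integral_sub (by exact (((B 0).add j1).add j2).add j3) j4,
      integral_add (by exact ((B 0).add j1).add j2) j3, integral_add (by exact (B 0).add j1) j2,
      integral_add (B 0) j1, integral_const_mul, integral_const_mul, integral_const_mul,
      integral_const_mul, B1]
    ring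
  rw [hpot, hkin, ← A2, ← B2] at hle
  rw [← A2, ← B2]
  have := mul_le_mul_of_nonneg_left hle hn'.le
  linarith

/-- A smooth bump supported in `[1, 4]`. -/
def logBump (τ : ℝ) : ℝ := Real.smoothTransition (τ - 1) * Real.smoothTransition (4 - τ)

theorem contDiff_logBump : ContDiff ℝ ∞ logBump := by
  have h1 : ContDiff ℝ ∞ fun τ : ℝ => τ - 1 := by fun_prop
  have h2 : ContDiff ℝ ∞ fun τ : ℝ => 4 - τ := by fun_prop
  exact (Real.smoothTransition.contDiff.comp h1).mul (Real.smoothTransition.contDiff.comp h2)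

theorem logBump_of_le {τ : ℝ} (h : τ ≤ 1) : logBump τ = 0 := by
  rw [logBump, Real.smoothTransition.zero_of_nonpos (by linarith), zero_mul]

theorem logBump_of_ge {τ : ℝ} (h : 4 ≤ τ) : logBump τ = 0 := by
  rw [logBump, Real.smoothTransition.zero_of_nonpos (x := 4 - τ) (by linarith), mul_zero]

theorem hasCompactSupport_logBump : HasCompactSupport logBump := by
  refine HasCompactSupport.intro (isCompact_Icc (a := 1) (b := 4)) fun τ hτ => ?_
  rw [Set.mem_Icc, not_and_or, not_le, not_le] at hτ
  rcases hτ with h | h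
  · exact logBump_of_le h.le
  · exact logBump_of_ge h.le

theorem integral_logBump_sq_pos : 0 < ∫ τ, logBump τ ^ 2 := by
  refine (contDiff_logBump.continuous.pow 2).integral_pos_of_hasCompactSupport_nonneg_nonzero
    (hasCompactSupport_logBump.comp_left (g := fun t : ℝ => t ^ 2) (by simp))
    (fun τ => sq_nonneg _) (x := 2) ?_
  rw [logBump, Real.smoothTransition.one_of_one_le (by norm_num),
    Real.smoothTransition.one_of_one_le (by norm_num)]
  norm_num

/-- The cross term `χ χ'` is half the derivative of `χ²`, so it integrates to zero. -/
theorem integral_deriv_sub_mul_sq {χ : ℝ → ℝ} (hχ : ContDiff ℝ ∞ χ) (hs : HasCompactSupport χ)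
    (a : ℝ) : ∫ τ, (deriv χ τ - a * χ τ) ^ 2 =
      (∫ τ, deriv χ τ ^ 2) + a ^ 2 * ∫ τ, χ τ ^ 2 := by
  have hc := hχ.continuous
  have hc' := hχ.continuous_deriv (by simp)
  have i1 : Integrable fun τ => deriv χ τ ^ 2 := by
    simp only [sq]
    exact (hc'.mul hc').integrable_of_hasCompactSupport hs.deriv.mul_right
  have i2 : Integrable fun τ => χ τ ^ 2 := by
    simp only [sq]
    exact (hc.mul hc).integrable_of_hasCompactSupport hs.mul_right
  have i3 : Integrable fun τ => χ τ * deriv χ τ :=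
    (hc.mul hc').integrable_of_hasCompactSupport hs.mul_right
  have i3' : Integrable fun τ => deriv χ τ * χ τ := by simpa only [mul_comm] using i3
  have hd : ∀ τ, HasDerivAt χ (deriv χ τ) τ := fun τ =>
    (hχ.differentiable (by simp) τ).hasDerivAt
  have h0 : ∫ τ, χ τ * deriv χ τ = 0 := by
    have := integral_mul_deriv_eq_deriv_mul_of_integrable (u := χ) (v := χ) (fun τ _ => hd τ)
      (fun τ _ => hd τ) i3 i3' (by
        change Integrable fun τ => χ τ * χ τ
        simpa only [sq] using i2)
    simp only [mul_comm (deriv χ _)] at this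
    linarith
  have : ∀ τ, (deriv χ τ - a * χ τ) ^ 2 =
      deriv χ τ ^ 2 + a ^ 2 * χ τ ^ 2 - 2 * a * (χ τ * deriv χ τ) := fun τ => by ring
  simp only [this]
  rw [integral_sub (by exact i1.add (i2.const_mul _)) (i3.const_mul _),
    integral_add i1 (i2.const_mul _), integral_const_mul, integral_const_mul, h0]
  ring

/-- The constraint on the coupling constant given by `|x|^{-(n-2)/2} χ(log |x|) (1 + t x₀ / |x|)`. -/
theorem DipoleHardy.log_profile {γ : ℝ} (h : DipoleHardy n γ) (hn : 2 ≤ n)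
    {χ : ℝ → ℝ} (hχ : ContDiff ℝ ∞ χ) (h1 : ∀ τ, τ < 1 → χ τ = 0)
    {L : ℝ} (hL : ∀ τ, L < τ → χ τ = 0) (t : ℝ) :
    γ * (2 * t * ∫ τ, χ τ ^ 2) ≤
      (n + t ^ 2) * ((∫ τ, deriv χ τ ^ 2) + (((n : ℝ) - 2) / 2) ^ 2 * ∫ τ, χ τ ^ 2) +
      t ^ 2 * (n - 1) * ∫ τ, χ τ ^ 2 := by
  let i₀ : Fin n := ⟨0, by omega⟩
  set a : ℝ := ((n : ℝ) - 2) / 2 with ha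
  have hs : HasCompactSupport χ := by
    refine HasCompactSupport.intro (isCompact_Icc (a := 1) (b := L)) fun τ hτ => ?_
    rw [Set.mem_Icc, not_and_or, not_le, not_le] at hτ
    exact hτ.elim (h1 τ) (hL τ)
  have hη : ContDiff ℝ ∞ fun τ => Real.exp (-a * τ) * χ τ :=
    ContDiff.mul (by fun_prop) hχ
  have key := h.logTrial i₀ hη (fun τ hτ => by rw [h1 τ hτ, mul_zero])
    (fun τ hτ => by rw [hL τ hτ, mul_zero]) t
  have hderiv : ∀ τ, deriv (fun τ => Real.exp (-a * τ) * χ τ) τ =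
      Real.exp (-a * τ) * (deriv χ τ - a * χ τ) := by
    intro τ
    have e1 : HasDerivAt (fun τ => Real.exp (-a * τ)) (Real.exp (-a * τ) * (-a * 1)) τ :=
      ((hasDerivAt_id τ).const_mul (-a)).exp
    rw [(e1.fun_mul (hχ.differentiable (by simp) τ).hasDerivAt).deriv]
    ring
  -- The critical decay `a = (n - 2) / 2` is chosen so that the volume factor cancels and the
  -- problem becomes translation invariant in `τ`.
  have hexp : ∀ τ y : ℝ, Real.exp ((n - 2) * τ) * (Real.exp (-a * τ) * y) ^ 2 = y ^ 2 := by
    intro τ y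
    rw [mul_pow, ← mul_assoc, ← Real.exp_nat_mul, ← Real.exp_add]
    have : ((n : ℝ) - 2) * τ + (2 : ℕ) * (-a * τ) = 0 := by
      rw [ha]
      push_cast
      ring
    rw [this, Real.exp_zero, one_mul]
  simp only [angularTerm, pow_zero, mul_one,
    integral_log_norm_div_norm_sq hn (fun τ => (Real.exp (-a * τ) * χ τ) ^ 2),
    integral_log_norm_div_norm_sq hn
      (fun τ => deriv (fun τ => Real.exp (-a * τ) * χ τ) τ ^ 2)] at key
  simp only [hderiv, hexp, integral_deriv_sub_mul_sq hχ hs] at key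
  have hball : 0 < volume.real (Metric.ball (0 : EuclideanSpace ℝ (Fin n)) 1) :=
    ENNReal.toReal_pos (Metric.measure_ball_pos volume 0 one_pos).ne' measure_ball_lt_top.ne
  have hn' : (0 : ℝ) < n := by
    have : 0 < n := by omega
    exact_mod_cast this
  refine le_of_mul_le_mul_left ?_ (mul_pos hn' hball)
  linarith

/-- Stretching the profile to `logBump (τ / k)` scales its mass by `k` and its derivative energy by
`1 / k`, so the latter disappears as `k → ∞`. What remains is the angular form tested on `1 + t cos
θ`. -/
theorem DipoleHardy.le_of_log_scaling {γ : ℝ} (h : DipoleHardy n γ) (hn : 2 ≤ n) (t : ℝ) :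
    γ * (2 * t) ≤ (n + t ^ 2) * (((n : ℝ) - 2) / 2) ^ 2 + t ^ 2 * (n - 1) := by
  set S := ∫ τ, logBump τ ^ 2 with hS
  set D := ∫ τ, deriv logBump τ ^ 2 with hD
  have hS0 : 0 < S := integral_logBump_sq_pos
  have hk : ∀ k : ℝ, 1 ≤ k → γ * (2 * t * S) ≤
      (n + t ^ 2) * (D / k ^ 2 + (((n : ℝ) - 2) / 2) ^ 2 * S) + t ^ 2 * (n - 1) * S := by
    intro k hk
    have hk0 : 0 < k := by linarith
    have hd : ∀ τ, deriv (fun τ => logBump (τ / k)) τ = deriv logBump (τ / k) / k := by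
      intro τ
      have e1 := (contDiff_logBump.differentiable (by simp) (τ / k)).hasDerivAt
      have e2 := e1.comp τ ((hasDerivAt_id τ).div_const k)
      exact e2.deriv.trans (by ring)
    -- The stretched bump lives on `[k, 4k]`, which stays to the right of `1` because `k ≥ 1`.
    have := h.log_profile hn (χ := fun τ => logBump (τ / k)) (L := 4 * k)
      (contDiff_logBump.comp (by fun_prop))
      (fun τ hτ => logBump_of_le (by rw [div_le_one hk0]; linarith))
      (fun τ hτ => logBump_of_ge (by rw [le_div_iff₀ hk0]; exact hτ.le)) t
    simp only [hd, div_pow] at this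
    rw [integral_div, Measure.integral_comp_div (fun τ => logBump τ ^ 2) k,
      Measure.integral_comp_div (fun τ => deriv logBump τ ^ 2) k, abs_of_pos hk0, smul_eq_mul,
      smul_eq_mul, ← hS, ← hD] at this
    refine le_of_mul_le_mul_left (le_trans (le_of_eq ?_) (this.trans_eq ?_)) hk0
    · ring
    · field_simp
  have hlim : Tendsto (fun k : ℝ => (n + t ^ 2) * (D / k ^ 2 + (((n : ℝ) - 2) / 2) ^ 2 * S)
      + t ^ 2 * (n - 1) * S) atTop
      (𝓝 ((n + t ^ 2) * (0 + (((n : ℝ) - 2) / 2) ^ 2 * S) + t ^ 2 * (n - 1) * S)) :=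
    (((tendsto_const_nhds.div_atTop (tendsto_pow_atTop two_ne_zero)).add_const _).const_mul
      _).add_const _
  have := ge_of_tendsto hlim ((eventually_ge_atTop 1).mono hk)
  refine le_of_mul_le_mul_right ?_ hS0
  linarith

/-! ### Upper bound for all dimensions, and asymptotics -/

/-- The optimal parameter is `t = (n - 2) / √n`. Replacing `1 / √n` by `2 / 5`, its value at `n = 25
/ 4`, keeps the bound rational and nearly optimal in the range where it is used. -/
theorem DipoleHardy.le_cubic {γ : ℝ} (h : DipoleHardy n γ) (hn : 3 ≤ n) :
    γ ≤ ((n : ℝ) - 2) * (25 * n + 4 * n ^ 2) / 80 := by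
  have hn' : (3 : ℝ) ≤ n := by exact_mod_cast hn
  have := h.le_of_log_scaling (by omega) (2 / 5 * ((n : ℝ) - 2))
  refine le_of_mul_le_mul_right (this.trans_eq ?_) (by linarith : 0 < 2 * (2 / 5 * ((n : ℝ) - 2)))
  ring

theorem DipoleHardy.le_upper_bound {γ : ℝ} (h : DipoleHardy n γ) (hγ : 0 ≤ γ) (hn : 3 ≤ n) :
    γ ≤ 15 * Real.pi * (((n : ℝ) - 2) * ((n : ℝ) - 4) + 4) / 32 := by
  have hpi := Real.pi_gt_d2
  have hfac : 0 < ((n : ℝ) - 2) * ((n : ℝ) - 4) + 4 := by nlinarith [sq_nonneg ((n : ℝ) - 3)]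
  have hstep : 15 * 3.14 * (((n : ℝ) - 2) * ((n : ℝ) - 4) + 4) / 32 ≤
      15 * Real.pi * (((n : ℝ) - 2) * ((n : ℝ) - 4) + 4) / 32 := by gcongr
  refine le_trans ?_ hstep
  -- The Gaussian bound suffices from `n = 11` on but fails at `n = 10`; the cubic bound covers the
  -- remaining dimensions.
  rcases le_or_gt n 10 with hn10 | hn10
  · refine (h.le_cubic hn).trans ?_
    interval_cases n <;> norm_num
  · have hn' : (11 : ℝ) ≤ n := by exact_mod_cast hn10
    refine (h.le_gaussian_bound hγ (by omega)).trans ?_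
    have h3 : √3 ≤ 1.7321 := Real.sqrt_le_iff.2 ⟨by norm_num, by norm_num⟩
    calc 3 * √3 / 8 * ((n : ℝ) * (n + 2)) ≤ 3 * 1.7321 / 8 * ((n : ℝ) * (n + 2)) := by gcongr
      _ ≤ _ := by nlinarith

theorem isGreatest_admissible (hn : 3 ≤ n) :
    IsGreatest (admissibleConstants n) (criticalConstant n) :=
  isGreatest_criticalConstant hn ⟨_, fun _ hc =>
    (mem_admissibleConstants_iff.1 hc).2.le_upper_bound hc.1 hn⟩

theorem le_criticalConstant (hn : 3 ≤ n) {γ : ℝ} (hγ : 0 ≤ γ) (h : DipoleHardy n γ) :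
    γ ≤ criticalConstant n :=
  (isGreatest_admissible hn).2 (mem_admissibleConstants_iff.2 ⟨hγ, h⟩)

theorem perp_bound_le_criticalConstant (hn : 4 ≤ n) :
    3 * √3 / 8 * ((n : ℝ) - 3) ^ 2 ≤ criticalConstant n :=
  le_criticalConstant (by omega) (by positivity) (dipoleHardy_of_le_perp hn (by positivity) le_rfl)

theorem criticalConstant_spec (hn : 3 ≤ n) :
    0 ≤ criticalConstant n ∧ DipoleHardy n (criticalConstant n) :=
  mem_admissibleConstants_iff.1 (isGreatest_admissible hn).1

theorem tendsto_natCast_ratio (p q : ℝ) :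
    Tendsto (fun n : ℕ => ((n : ℝ) - p) * (n - q) / (((n : ℝ) - 2) * (n - 4))) atTop (𝓝 1) := by
  have h : ∀ r : ℝ, Tendsto (fun n : ℕ => 1 - r / (n : ℝ)) atTop (𝓝 1) := fun r => by
    simpa using (tendsto_const_div_atTop_nhds_zero_nat r).const_sub 1
  have := ((h p).mul (h q)).div ((h 2).mul (h 4)) (by norm_num)
  simp only [mul_one, div_one] at this
  refine this.congr' ?_
  filter_upwards [eventually_gt_atTop 4] with n hn
  have hn' : (4 : ℝ) < n := by exact_mod_cast hn
  have h0 : (n : ℝ) ≠ 0 := by linarith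
  have h2 : (n : ℝ) - 2 ≠ 0 := by linarith
  have h4 : (n : ℝ) - 4 ≠ 0 := by linarith
  simp only [Pi.div_apply]
  have e : ∀ r : ℝ, 1 - r / (n : ℝ) = (n - r) / n := fun r => by field_simp
  simp only [e]
  field_simp

/-- Squeeze: divided by the comparison function, the axis Hardy bound is `(n - 3)² / ((n - 2)(n -
4))` and the Gaussian bound is `n (n + 2) / ((n - 2)(n - 4))`. The constant `3√3 / 8` is common to
both. -/
theorem isEquivalent_criticalConstant :
    Asymptotics.IsEquivalent atTop (fun n : ℕ => criticalConstant n)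
      (fun n : ℕ => 3 * √3 / 8 * (((n : ℝ) - 2) * ((n : ℝ) - 4))) := by
  have hpos : ∀ n : ℕ, 4 < n → 0 < 3 * √3 / 8 * (((n : ℝ) - 2) * ((n : ℝ) - 4)) := by
    intro n hn
    have hn' : (4 : ℝ) < n := by exact_mod_cast hn
    exact mul_pos (by positivity) (mul_pos (by linarith) (by linarith))
  rw [Asymptotics.isEquivalent_iff_tendsto_one
    ((eventually_gt_atTop 4).mono fun n hn => (hpos n hn).ne')]
  refine tendsto_of_tendsto_of_tendsto_of_le_of_le' (tendsto_natCast_ratio 3 3)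
    (tendsto_natCast_ratio 0 (-2)) ?_ ?_
  · filter_upwards [eventually_gt_atTop 4] with n hn
    rw [Pi.div_apply, le_div_iff₀ (hpos n hn)]
    refine le_trans (le_of_eq ?_) (perp_bound_le_criticalConstant hn.le)
    have := (hpos n hn).ne'
    rw [mul_left_comm, div_mul_cancel₀ _ (mul_ne_zero_iff.1 this).2, sq]
  · filter_upwards [eventually_gt_atTop 4] with n hn
    rw [Pi.div_apply, div_le_iff₀ (hpos n hn)]
    obtain ⟨h0, h1⟩ := criticalConstant_spec (n := n) (by omega)
    refine (h1.le_gaussian_bound h0 (by omega)).trans (le_of_eq ?_)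
    have := (hpos n hn).ne'
    rw [mul_left_comm (_ / (_ * _)), div_mul_cancel₀ _ (mul_ne_zero_iff.1 this).2]
    ring

end Dipole

end

theorem theorem3p3 :
    (∀ n : ℕ, 3 ≤ n →
      IsGreatest (Dipole.admissibleConstants n) (Dipole.criticalConstant n)) ∧
    (∃ C₀ : ℝ, 0 < C₀ ∧
      Asymptotics.IsEquivalent Filter.atTop
        (fun n : ℕ => Dipole.criticalConstant n)
        (fun n : ℕ => C₀ * (((n : ℝ) - 2) * ((n : ℝ) - 4)))) ∧
    (∀ n : ℕ, 3 ≤ n →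
      Dipole.criticalConstant n ≤
        15 * Real.pi * (((n : ℝ) - 2) * ((n : ℝ) - 4) + 4) / 32) ∧
    1 / 4 ≤ Dipole.criticalConstant 3 ∧
    1 ≤ Dipole.criticalConstant 4 ∧
    (∀ n : ℕ, 5 ≤ n →
      (3 : ℝ) ^ (3 / 2 : ℝ) * (((n : ℝ) - 2) * ((n : ℝ) - 4) + 1) / 8 ≤
        Dipole.criticalConstant n) := by
  refine ⟨fun n hn => Dipole.isGreatest_admissible hn,
    ⟨3 * √3 / 8, by positivity, Dipole.isEquivalent_criticalConstant⟩, fun n hn => ?_, ?_, ?_,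
    fun n hn => ?_⟩
  · obtain ⟨h0, h1⟩ := Dipole.criticalConstant_spec hn
    exact h1.le_upper_bound h0 hn
  · exact Dipole.le_criticalConstant le_rfl (by norm_num)
      (Dipole.dipoleHardy_of_le_sq le_rfl (by norm_num) (by norm_num))
  · exact Dipole.le_criticalConstant (by norm_num) (by norm_num)
      (Dipole.dipoleHardy_of_le_sq (by norm_num) (by norm_num) (by norm_num))
  · have h3 : (3 : ℝ) ^ (3 / 2 : ℝ) = 3 * √3 := by
      rw [show (3 / 2 : ℝ) = 1 + 1 / 2 by norm_num, Real.rpow_add (by norm_num), Real.rpow_one,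
        Real.sqrt_eq_rpow]
    refine le_trans (le_of_eq ?_) (Dipole.perp_bound_le_criticalConstant (n := n) (by omega))
    rw [h3]
    ring
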